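/- Let $\Gamma$ be a connected finite simplicial graph with at least $2$ vertices. Let $A_\Gamma$ be its right-angled Artin group, generated by the vertices of $\Gamma$ with the relations $st=ts$ for adjacent $s,t$, and let the Bestvina–Brady subgroup $H_\Gamma$ be the kernel of the homomorphism $A_\Gamma\to\mathbb Z$ sending every vertex to $1$. Then $H_\Gamma$ is finitely generated, and for all finite generating sets $S$ of $A_\Gamma$ and $T$ of $H_\Gamma$ the following holds: if $\Gamma$ is a join (of two nonempty graphs), then the relative divergence $Div(A_\Gamma,H_\Gamma)$ (computed with $S$) and the subgroup distortion $Dist^{H_\Gamma}_{A_\Gamma}$ (computed with $S$ and $T$) are both linear; otherwise both are quadratic. Here $\Gamma$ is a join if its vertex set is a disjoint union of two nonempty sets such that every vertex of the first is adjacent to every vertex of the second. The other notions are as follows. For $f,g:[0,\infty)\to[0,\infty]$ write $f\preceq g$ if there are positive constants $A,B,C,D$ with $f(x)\le A\,g(Bx)+Cx$ for all $x>D$, and $f\sim g$ if $f\preceq g$ and $g\preceq f$. For families $\{\delta^n_\rho\},\{\delta'^n_\rho\}$ of such functions, indexed by $\rho\in(0,1]$ and integers $n\ge2$, write $\{\delta^n_\rho\}\preceq\{\delta'^n_\rho\}$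 if there are $L\in(0,1]$ and a positive integer $M$ with $\delta^n_{L\rho}\preceq\delta'^{Mn}_\rho$ for all $n\geq 2$ and $\rho\in(0,1]$; they are equivalent if each dominates the other. A function (or a family) is linear, resp. quadratic, if it is equivalent to every polynomial (or to the constant family given by every polynomial) of degree $1$, resp. $2$, that is nonnegative on $[0,\infty)$. Let $G$ be a group with a finite generating set $S$, and $H$ a subgroup of $G$. Let $X$ be the Cayley graph of $(G,S)$, a geodesic space with edges of length $1$ and metric $d$, in which $H$ is regarded as a set of vertices. For $r\geq 0$ let $d_r$ be the induced length metric on $\{x\in X: d(x,H)\ge r\}$: the infimum of the lengths of paths in this set, and $\infty$ if there are none. The relative divergence $Div(G,H)$ is the family $$\delta^n_\rho(r)=\sup d_{\rho r}(x_1,x_2),$$ the supremum over all $x_1,x_2\in X$ with $d(x_1,H)=d(x_2,H)=r$, $d_r(x_1,x_2)<\infty$ and $d(x_1,x_2)\le nr$. If $T$ is a finite generating set of $H$, the subgroup distortion is $$Dist^H_G(r)=\max\{|h|_T : h\in H,\ |h|_S\le r\},$$ where $|\cdot|_S,|\cdot|_T$ denote word lengths. -/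

import Mathlib

open scoped NNReal ENNReal

/-! ### Domination and equivalence of functions and of families of functions -/

/-- `f ⪯ g` for functions `[0, ∞) → [0, ∞]`: there are positive constants `A, B, C, D` with
`f x ≤ A * g (B * x) + C * x` for all `x > D`. -/
def Dominated (f g : ℝ≥0 → ℝ≥0∞) : Prop :=
  ∃ A B C D : ℝ≥0, 0 < A ∧ 0 < B ∧ 0 < C ∧ 0 < D ∧
    ∀ x : ℝ≥0, D < x → f x ≤ A * g (B * x) + C * x

/-- `f ∼ g`. -/
def FunEquiv (f g : ℝ≥0 → ℝ≥0∞) : Prop :=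
  Dominated f g ∧ Dominated g f

/-- Domination of families `δ n ρ : [0, ∞) → [0, ∞]`. Only the indices `n ≥ 2` and `ρ ∈ (0, 1]`
are used. -/
def FamilyDominated (δ δ' : ℕ → ℝ≥0 → ℝ≥0 → ℝ≥0∞) : Prop :=
  ∃ L : ℝ≥0, 0 < L ∧ L ≤ 1 ∧ ∃ M : ℕ, 0 < M ∧
    ∀ n : ℕ, 2 ≤ n → ∀ ρ : ℝ≥0, 0 < ρ → ρ ≤ 1 → Dominated (δ n (L * ρ)) (δ' (M * n) ρ)

/-- Equivalence of families. -/
def FamilyEquiv (δ δ' : ℕ → ℝ≥0 → ℝ≥0 → ℝ≥0∞) : Prop :=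
  FamilyDominated δ δ' ∧ FamilyDominated δ' δ

/-- A real polynomial, regarded as a function `[0, ∞) → [0, ∞]` (used only for polynomials that
are nonnegative on `[0, ∞)`). -/
noncomputable def polyFun (p : Polynomial ℝ) (x : ℝ≥0) : ℝ≥0∞ :=
  ENNReal.ofReal (p.eval (x : ℝ))

/-- `f` is equivalent to any polynomial of degree `k` that is nonnegative on `[0, ∞)`: linear for
`k = 1`, quadratic for `k = 2`. -/
def HasPolyGrowth (k : ℕ) (f : ℝ≥0 → ℝ≥0∞) : Prop :=
  ∀ p : Polynomial ℝ, p.natDegree = k → (∀ x : ℝ, 0 ≤ x → 0 ≤ p.eval x) → FunEquiv f (polyFun p)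

/-- The same for a family: it is equivalent to the constant family of value `p`, for any
polynomial `p` of degree `k` that is nonnegative on `[0, ∞)`. -/
def FamilyHasPolyGrowth (k : ℕ) (δ : ℕ → ℝ≥0 → ℝ≥0 → ℝ≥0∞) : Prop :=
  ∀ p : Polynomial ℝ, p.natDegree = k → (∀ x : ℝ, 0 ≤ x → 0 ≤ p.eval x) →
    FamilyEquiv δ (fun _ _ => polyFun p)

/-! ### Relative divergence of a metric space with respect to a subspace -/

section Divergence

variable {X : Type*} [PseudoEMetricSpace X]

/-- The induced length metric on `C ⊆ X`: the infimum of the lengths of the paths in `C` from `x`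
to `y`, and `∞` if there is none. -/
noncomputable def lengthDist (C : Set X) (x y : X) : ℝ≥0∞ :=
  ⨅ (γ : Path x y) (_ : ∀ t, γ t ∈ C), eVariationOn γ Set.univ

/-- The open `r`-neighborhood `N_r(A)`. -/
def nbhd (A : Set X) (r : ℝ≥0) : Set X := {x | Metric.infEDist x A < r}

/-- `∂N_r(A)`, the set of the points at distance exactly `r` from `A`. -/
def nbhdBoundary (A : Set X) (r : ℝ≥0) : Set X := {x | Metric.infEDist x A = r}

/-- The distance `d_r = d_{r, A}`, the induced length metric on `C_r(A) = X - N_r(A)`. -/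
noncomputable def outerDist (A : Set X) (r : ℝ≥0) (x y : X) : ℝ≥0∞ :=
  lengthDist (nbhd A r)ᶜ x y

/-- The relative divergence `Div(X, A)`, the family of the functions `δ n ρ` with
`δ n ρ r = sup d_{ρ r}(x₁, x₂)` over all `x₁, x₂ ∈ ∂N_r(A)` with `d_r(x₁, x₂) < ∞` and
`d(x₁, x₂) ≤ n * r`. -/
noncomputable def relDivergence (A : Set X) (n : ℕ) (ρ r : ℝ≥0) : ℝ≥0∞ :=
  ⨆ (x₁ : X) (x₂ : X) (_ : x₁ ∈ nbhdBoundary A r) (_ : x₂ ∈ nbhdBoundary A r)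
    (_ : outerDist A r x₁ x₂ < ⊤) (_ : edist x₁ x₂ ≤ (n : ℝ≥0∞) * r),
    outerDist A (ρ * r) x₁ x₂

end Divergence

/-! ### The geometric realization of a graph as a metric space -/

/-- The closed cell spanned by `u` and `v`, in barycentric coordinates: a closed edge if
`u ≠ v`, the single vertex `u` if `u = v`. -/
def cellSet {V : Type*} (u v : V) : Set (V →₀ ℝ) :=
  segment ℝ (Finsupp.single u (1 : ℝ)) (Finsupp.single v (1 : ℝ))

/-- The geometric realization of a simple graph, in barycentric coordinates: the union of its
vertices and of its closed edges. -/
@[ext]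
structure Realization {V : Type*} (G : SimpleGraph V) where
  coords : V →₀ ℝ
  mem_cell : ∃ u v, (u = v ∨ G.Adj u v) ∧ coords ∈ cellSet u v

namespace Realization

variable {V : Type*} {G : SimpleGraph V}

/-- The point of the realization given by a vertex. -/
noncomputable def vertex (G : SimpleGraph V) (v : V) : Realization G where
  coords := Finsupp.single v 1
  mem_cell := ⟨v, v, Or.inl rfl, left_mem_segment ℝ _ _⟩

/-- Two points lie on a common closed edge (or are the same vertex). -/
def SameCell (x y : Realization G) : Prop :=
  ∃ u v, (u = v ∨ G.Adj u v) ∧ x.coords ∈ cellSet u v ∧ y.coords ∈ cellSet u v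

/-- The distance of two points of a common closed edge, for which the edge has length `1`: on the
edge from `u` to `v` both coordinate differences have the same absolute value. -/
noncomputable def cellDist (x y : Realization G) : ℝ≥0∞ :=
  ⨆ v, edist (x.coords v) (y.coords v)

/-- `PolyLength x y c`: some polygonal path from `x` to `y`, each step of which stays in one closed
edge, has length `c`. -/
inductive PolyLength : Realization G → Realization G → ℝ≥0∞ → Prop
  | nil (x : Realization G) : PolyLength x x 0
  | cons {x y z : Realization G} {c : ℝ≥0∞} :
      SameCell x y → PolyLength y z c → PolyLength x z (cellDist x y + c)

theorem SameCell.symm {x y : Realization G} (h : SameCell x y) : SameCell y x := by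
  obtain ⟨u, v, huv, hx, hy⟩ := h
  exact ⟨u, v, huv, hy, hx⟩

theorem cellDist_comm (x y : Realization G) : cellDist x y = cellDist y x := by
  simp only [cellDist, edist_comm]

theorem PolyLength.append {x y z : Realization G} {c d : ℝ≥0∞} (h : PolyLength x y c)
    (h' : PolyLength y z d) : PolyLength x z (c + d) := by
  induction h with
  | nil x => simpa using h'
  | cons hxy _ ih => rw [add_assoc]; exact .cons hxy (ih h')

theorem PolyLength.symm {x y : Realization G} {c : ℝ≥0∞} (h : PolyLength x y c) :
    PolyLength y x c := by
  induction h with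
  | nil x => exact .nil x
  | @cons x y z c hxy _ ih =>
    have h1 : PolyLength y x (cellDist y x + 0) := .cons hxy.symm (.nil x)
    have h2 := ih.append h1
    rwa [add_zero, cellDist_comm, add_comm] at h2

theorem PolyLength.edist_coords_le {x y : Realization G} {c : ℝ≥0∞} (h : PolyLength x y c)
    (v : V) : edist (x.coords v) (y.coords v) ≤ c := by
  induction h with
  | nil x => simp
  | @cons x y z c _ _ ih =>
    exact (edist_triangle _ (y.coords v) _).trans
      (add_le_add (le_iSup (fun v => edist (x.coords v) (y.coords v)) v) ih)

/-- The path metric on the realization in which each edge is isometric to the unit interval: the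
infimum of the lengths of the polygonal paths (`∞` between different components). -/
noncomputable instance : EMetricSpace (Realization G) where
  edist x y := sInf {c | PolyLength x y c}
  edist_self x := le_antisymm (sInf_le (PolyLength.nil x)) zero_le
  edist_comm x y := by
    congr 1
    ext c
    exact ⟨PolyLength.symm, PolyLength.symm⟩
  edist_triangle x y z := by
    rw [ENNReal.sInf_add, le_iInf₂_iff]
    intro c hc
    rw [add_comm, ENNReal.sInf_add, le_iInf₂_iff]
    intro d hd
    rw [add_comm]
    exact sInf_le (PolyLength.append hc hd)
  eq_of_edist_eq_zero {x y} h := by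
    ext v
    have hle : edist (x.coords v) (y.coords v) ≤ sInf {c | PolyLength x y c} :=
      le_sInf fun c hc => PolyLength.edist_coords_le hc v
    exact edist_le_zero.1 (hle.trans h.le)

end Realization

/-! ### Relative divergence and distortion for groups -/

/-- `Div(G, H)` computed with the generating set `S`: the relative divergence of the Cayley graph,
as a geodesic space with edges of length `1`, with respect to the set of vertices `H`. -/
noncomputable def groupDivergence {G : Type*} [Group G] (S : Set G) (H : Subgroup G) :
    ℕ → ℝ≥0 → ℝ≥0 → ℝ≥0∞ :=
  relDivergence (Realization.vertex (SimpleGraph.mulCayley S) '' (H : Set G))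

/-- The word length `|g|_S`, the least length of a word in `S ∪ S⁻¹` representing `g` (for a
generating set `S`). -/
noncomputable def wordLength {G : Type*} [Group G] (S : Set G) (g : G) : ℕ :=
  sInf {n | ∃ w : List G, (∀ s ∈ w, s ∈ S ∨ s⁻¹ ∈ S) ∧ w.prod = g ∧ w.length = n}

/-- The subgroup distortion of `H` in `G`, for generating sets `S` of `G` and `T` of `H`:
`r ↦ max {|h|_T : h ∈ H, |h|_S ≤ r}`. -/
noncomputable def distortion {G : Type*} [Group G] (S : Set G) (H : Subgroup G) (T : Set H)
    (r : ℝ≥0) : ℝ≥0∞ :=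
  ⨆ (h : H) (_ : (wordLength S (h : G) : ℝ≥0) ≤ r), (wordLength T h : ℝ≥0∞)

/-! ### Right-angled Artin groups, Bestvina–Brady subgroups, joins -/

/-- The right-angled Artin group: generated by the vertices, with the relation `s t = t s`
whenever `s` and `t` are adjacent. -/
abbrev RAAG {V : Type*} (Γ : SimpleGraph V) : Type _ :=
  PresentedGroup {w : FreeGroup V | ∃ s t, Γ.Adj s t ∧
    w = FreeGroup.of s * FreeGroup.of t * (FreeGroup.of s)⁻¹ * (FreeGroup.of t)⁻¹}

/-- The homomorphism from the right-angled Artin group to `ℤ` sending each generator to `1`. -/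
def raagHeight {V : Type*} (Γ : SimpleGraph V) : RAAG Γ →* Multiplicative ℤ :=
  PresentedGroup.toGroup (f := fun _ => Multiplicative.ofAdd 1) (by
    rintro w ⟨s, t, -, rfl⟩
    simp)

/-- The Bestvina–Brady subgroup. -/
def bestvinaBrady {V : Type*} (Γ : SimpleGraph V) : Subgroup (RAAG Γ) := (raagHeight Γ).ker

/-- `Γ` is a join (of two nonempty graphs): its vertex set is the disjoint union of two nonempty
sets such that every vertex of the first is adjacent to every vertex of the second. -/
def IsJoin {V : Type*} (Γ : SimpleGraph V) : Prop :=
  ∃ s : Set V, s.Nonempty ∧ sᶜ.Nonempty ∧ ∀ u ∈ s, ∀ v ∈ sᶜ, Γ.Adj u v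

/-!
Let `height : A_Γ → ℤ` be the homomorphism with kernel `H_Γ`. Up to multiplicative and additive
constants, the distance from `H_Γ` in the Cayley graph is `|height|`
(`RAAG.mem_compl_nbhd`, `RAAG.exists_le_abs_realHeight`), so that a path outside a neighborhood of
`H_Γ` is a path along which the height stays large, of one sign.

*Upper bounds for the distortion.* The elements `s * t⁻¹`, for the edges `s t` of `Γ`, generate
`H_Γ`: along a path of `Γ` from `t` to `s` one writes `t ^ n * s ^ (-n)` as a product of `O(|n|)` of
them, because adjacent vertices commute. Bringing the letters of a word of length `n` one after the
other back to height `0` by powers of a fixed vertex takes a product of `O(n ^ 2)` edges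
(`RAAG.exists_edgeWord_quadratic`). In a join `A_Γ` is a direct product, and the letters of each
factor can be compensated by a vertex of the other factor at once, which takes `O(n)` edges
(`RAAG.exists_edgeWord_join`).

*Upper bounds for the divergence.* Two points far from `H_Γ` and on the same side are joined by
a path that follows the powers of a vertex to the height of the second point and then stays close to
a coset of `H_Γ`. Its length is governed by the distortion (`RAAG.exists_high_walk`,
`RAAG.exists_groupDivergence_le`).

*Lower bounds.* If `Γ` is not a join, the complement of `Γ` is connected, and a closed walk in
it through all the vertices gives a periodic sequence of letters, consecutive ones of which do not
commute. Read negatively for a multiple of `r` steps and then positively for as many, it spells an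
element of `H_Γ` of length `O(r)`. The hyperplanes crossed by the word are nested
(`RAAG.halfSpace_nested`), so that every path with the same ends crosses them in the same
order. A path that does not go deeper than `r` crosses a hyperplane at depth at least `2 r` at a
point `x * a`, where `x` lies on the word, `a` has height at least `r` and is a product of vertices
adjacent to the label of the hyperplane. Some exponent sum of `a` is then at least `r / |V|`. The
corresponding exponent sum vanishes when, a bounded number of letters later, a hyperplane labelled
by that same vertex is crossed, hence the path makes at least `r / |V| - O(1)` steps in between
(`RAAG.le_crossing_times_sub`). There are `r` such blocks, and the path has length at least
a multiple of `r ^ 2 - O(r)` (`RAAG.exists_long_detour`). A path inside `H_Γ` does not go deeper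
than a constant, which gives the lower bound for the distortion. For the divergence the ends of the path
are placed at a height of order `r`; a path outside a neighborhood of `H_Γ` that is larger than
a constant stays at positive height (`RAAG.exists_sq_le_lengthDist`).

The half-spaces are defined algebraically, by the action of `A_Γ` on the integer-valued functions on
the hyperplanes with a given label (`RAAG.crossing`): no normal forms of words are needed.
-/

/-! ### Word length and coarse paths in Cayley graphs -/

section WordLength

variable {G : Type*} [Group G]

theorem wordLength_le_of_word {S : Set G} {w : List G} (hw : ∀ s ∈ w, s ∈ S ∨ s⁻¹ ∈ S) :
    wordLength S w.prod ≤ w.length :=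
  Nat.sInf_le ⟨w, hw, rfl, rfl⟩

theorem exists_word {S : Set G} (hS : Subgroup.closure S = ⊤) (g : G) :
    ∃ w : List G, (∀ s ∈ w, s ∈ S ∨ s⁻¹ ∈ S) ∧ w.prod = g ∧ w.length = wordLength S g := by
  have h : {n | ∃ w : List G,
      (∀ s ∈ w, s ∈ S ∨ s⁻¹ ∈ S) ∧ w.prod = g ∧ w.length = n}.Nonempty := by
    have hg : g ∈ Submonoid.closure (S ∪ S⁻¹) := by
      rw [← Subgroup.closure_toSubmonoid, hS]; trivial
    obtain ⟨w, hw, hg⟩ := Submonoid.exists_list_of_mem_closure hg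
    exact ⟨w.length, w, hw, hg, rfl⟩
  exact Nat.sInf_mem h

theorem wordLength_one (S : Set G) : wordLength S 1 = 0 := by
  have := wordLength_le_of_word (S := S) (w := []) (by simp)
  simpa using this

theorem wordLength_mul_le {S : Set G} (hS : Subgroup.closure S = ⊤) (g g' : G) :
    wordLength S (g * g') ≤ wordLength S g + wordLength S g' := by
  obtain ⟨w, hw, rfl, hl⟩ := exists_word hS g
  obtain ⟨w', hw', rfl, hl'⟩ := exists_word hS g'
  rw [← hl, ← hl', ← List.prod_append, ← List.length_append]
  refine wordLength_le_of_word fun s hs => ?_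
  rcases List.mem_append.1 hs with h | h
  exacts [hw s h, hw' s h]

theorem wordLength_inv_le {S : Set G} (hS : Subgroup.closure S = ⊤) (g : G) :
    wordLength S g⁻¹ ≤ wordLength S g := by
  obtain ⟨w, hw, rfl, hl⟩ := exists_word hS g
  rw [← hl, List.prod_inv_reverse]
  refine (wordLength_le_of_word fun s hs => ?_).trans (by simp)
  simp only [List.mem_reverse, List.mem_map] at hs
  obtain ⟨t, ht, rfl⟩ := hs
  simpa [or_comm] using hw t ht

theorem wordLength_inv {S : Set G} (hS : Subgroup.closure S = ⊤) (g : G) :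
    wordLength S g⁻¹ = wordLength S g :=
  (wordLength_inv_le hS g).antisymm (by simpa using wordLength_inv_le hS g⁻¹)

theorem wordLength_of_mem {S : Set G} {s : G} (hs : s ∈ S) : wordLength S s ≤ 1 := by
  simpa using wordLength_le_of_word (S := S) (w := [s]) (by simp [hs])

/-- A length function on a group (symmetric, subadditive, zero at `1`) that is at most `c` on a
generating set is at most `c` times the word length. -/
theorem le_mul_wordLength {S : Set G} (hS : Subgroup.closure S = ⊤) {N : G → ℕ} {c : ℕ}
    (h1 : N 1 = 0) (hmul : ∀ x y, N (x * y) ≤ N x + N y) (hinv : ∀ x, N x⁻¹ = N x)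
    (hc : ∀ s ∈ S, N s ≤ c) (g : G) : N g ≤ c * wordLength S g := by
  obtain ⟨w, hw, rfl, hl⟩ := exists_word hS g
  rw [← hl]
  clear hl
  induction w with
  | nil => simp [h1]
  | cons s w ih =>
    have h2 : N s ≤ c := by
      rcases hw s (by simp) with h | h
      · exact hc s h
      · rw [← hinv]; exact hc _ h
    have h3 := ih fun t ht => hw t (by simp [ht])
    have h4 := hmul s w.prod
    rw [List.prod_cons, List.length_cons]
    lia

theorem wordLength_pow_le {S : Set G} (hS : Subgroup.closure S = ⊤) (g : G) (n : ℕ) :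
    wordLength S (g ^ n) ≤ n * wordLength S g := by
  induction n with
  | zero => simp [wordLength_one]
  | succ n ih =>
    have := wordLength_mul_le hS (g ^ n) g
    rw [pow_succ, Nat.add_mul]
    lia

theorem wordLength_zpow_le {S : Set G} (hS : Subgroup.closure S = ⊤) (g : G) (n : ℤ) :
    wordLength S (g ^ n) ≤ n.natAbs * wordLength S g := by
  obtain ⟨m, rfl | rfl⟩ := n.eq_nat_or_neg
  · simpa using wordLength_pow_le hS g m
  · simpa [wordLength_inv hS] using wordLength_pow_le hS g m

theorem wordLength_map_le {G' : Type*} [Group G'] {S : Set G} (hS : Subgroup.closure S = ⊤)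
    {S' : Set G'} (hS' : Subgroup.closure S' = ⊤) (φ : G →* G') {c : ℕ}
    (hc : ∀ s ∈ S, wordLength S' (φ s) ≤ c) (g : G) :
    wordLength S' (φ g) ≤ c * wordLength S g :=
  le_mul_wordLength (N := fun g => wordLength S' (φ g)) hS (by simp [wordLength_one])
    (fun x y => by simpa using wordLength_mul_le hS' _ _) (fun x => by simp [wordLength_inv hS'])
    hc g

theorem natAbs_hom_le {S : Set G} (hS : Subgroup.closure S = ⊤) (φ : G →* Multiplicative ℤ) {c : ℕ}
    (hc : ∀ s ∈ S, (φ s).toAdd.natAbs ≤ c) (g : G) :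
    (φ g).toAdd.natAbs ≤ c * wordLength S g :=
  le_mul_wordLength (N := fun g => (φ g).toAdd.natAbs) hS (by simp)
    (fun x y => by simpa using Int.natAbs_add_le _ _) (fun x => by simp) hc g

theorem exists_bound_of_finite {α : Type*} {S : Set α} (hS : S.Finite) (f : α → ℕ) :
    ∃ c, ∀ s ∈ S, f s ≤ c := by
  obtain ⟨c, hc⟩ := (hS.image f).bddAbove
  exact ⟨c, fun s hs => hc ⟨s, hs, rfl⟩⟩

/-- Adjacent vertices of a Cayley graph differ by an element of length at most `1`. -/
theorem wordLength_le_one_of_adj {S : Set G} (hS : Subgroup.closure S = ⊤) {x y : G}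
    (h : (SimpleGraph.mulCayley S).Adj x y) : wordLength S (x⁻¹ * y) ≤ 1 := by
  rw [SimpleGraph.mulCayley_adj'] at h
  obtain ⟨-, g, hg, rfl | rfl⟩ := h
  · simpa using wordLength_of_mem hg
  · simpa [wordLength_inv hS] using wordLength_of_mem hg

theorem exists_walk_of_word {S : Set G} (w : List G) (hw : ∀ s ∈ w, s ∈ S ∨ s⁻¹ ∈ S) (x y : G)
    (hy : x * w.prod = y) : ∃ p : (SimpleGraph.mulCayley S).Walk x y, p.length ≤ w.length := by
  induction w generalizing x with
  | nil =>
    obtain rfl : x = y := by simpa using hy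
    exact ⟨.nil, le_rfl⟩
  | cons s w ih =>
    have ih := ih (fun t ht => hw t (by simp [ht])) (x * s) (by rw [← hy]; simp [mul_assoc])
    by_cases h : x * s = x
    · rw [h] at ih
      obtain ⟨p, hp⟩ := ih
      exact ⟨p, hp.trans (by simp)⟩
    · have hadj : (SimpleGraph.mulCayley S).Adj x (x * s) := by
        rw [SimpleGraph.mulCayley_adj']
        refine ⟨Ne.symm h, ?_⟩
        rcases hw s (by simp) with hs | hs
        · exact ⟨s, hs, Or.inl rfl⟩
        · exact ⟨s⁻¹, hs, Or.inr (by simp)⟩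
      obtain ⟨p, hp⟩ := ih
      exact ⟨.cons hadj p, by simpa using hp⟩

theorem exists_walk {S : Set G} (hS : Subgroup.closure S = ⊤) (x y : G) :
    ∃ p : (SimpleGraph.mulCayley S).Walk x y, p.length ≤ wordLength S (x⁻¹ * y) := by
  obtain ⟨w, hw, hg, hl⟩ := exists_word hS (x⁻¹ * y)
  rw [← hl]
  exact exists_walk_of_word w hw x y (by simp [hg])

theorem wordLength_le_length {S : Set G} (hS : Subgroup.closure S = ⊤) {x y : G}
    (p : (SimpleGraph.mulCayley S).Walk x y) : wordLength S (x⁻¹ * y) ≤ p.length := by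
  induction p with
  | nil => simp [wordLength_one]
  | @cons x y z h p ih =>
    have h1 := wordLength_mul_le hS (x⁻¹ * y) (y⁻¹ * z)
    have h2 := wordLength_le_one_of_adj hS h
    rw [show x⁻¹ * y * (y⁻¹ * z) = x⁻¹ * z by group] at h1
    rw [SimpleGraph.Walk.length_cons]
    lia

theorem wordLength_le_length_of_mem_support {S : Set G} (hS : Subgroup.closure S = ⊤) {x y z : G}
    (p : (SimpleGraph.mulCayley S).Walk x y) (hz : z ∈ p.support) :
    wordLength S (x⁻¹ * z) ≤ p.length := by
  classical
  exact (wordLength_le_length hS (p.takeUntil z hz)).trans (p.length_takeUntil_le_length hz)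

/-- A coarse path, whose steps have length at most `c`, is followed by a walk in the Cayley graph
that stays `c`-close to it. -/
theorem exists_walk_of_chain {S : Set G} (hS : Subgroup.closure S = ⊤) {c : ℕ} (v : ℕ → G) (n : ℕ)
    (hv : ∀ i < n, wordLength S ((v i)⁻¹ * v (i + 1)) ≤ c) {x y : G} (hx : v 0 = x) (hy : v n = y) :
    ∃ p : (SimpleGraph.mulCayley S).Walk x y, p.length ≤ c * n ∧
      ∀ z ∈ p.support, ∃ i ≤ n, wordLength S ((v i)⁻¹ * z) ≤ c := by
  subst hx
  induction n generalizing y with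
  | zero =>
    subst hy
    exact ⟨.nil, by simp, fun z hz => ⟨0, by simp_all [wordLength_one]⟩⟩
  | succ n ih =>
    subst hy
    obtain ⟨p, hp, hp'⟩ := ih (fun i hi => hv i (by lia)) rfl
    obtain ⟨q, hq⟩ := exists_walk hS (v n) (v (n + 1))
    have hn := hv n (by lia)
    refine ⟨p.append q, ?_, fun z hz => ?_⟩
    · rw [SimpleGraph.Walk.length_append, Nat.mul_add]
      lia
    · rcases (SimpleGraph.Walk.mem_support_append_iff _ _).1 hz with h | h
      · obtain ⟨i, hi, h⟩ := hp' z h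
        exact ⟨i, by lia, h⟩
      · exact ⟨n, by lia, (wordLength_le_length_of_mem_support hS q h).trans (hq.trans hn)⟩

/-- A word whose letters have `S`-length at most `c` is followed by a walk in the Cayley graph
of `S`. -/
theorem exists_walk_of_map {G' : Type*} [Group G'] {T : Set G'} (hT : Subgroup.closure T = ⊤)
    {S : Set G} (hS : Subgroup.closure S = ⊤) (φ : G' →* G) {c : ℕ}
    (hc : ∀ t ∈ T, wordLength S (φ t) ≤ c) (x y : G) (g : G')
    (hy : x * φ g = y) :
    ∃ p : (SimpleGraph.mulCayley S).Walk x y, p.length ≤ c * wordLength T g ∧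
      ∀ z ∈ p.support, ∃ g' : G', wordLength S ((x * φ g')⁻¹ * z) ≤ c := by
  obtain ⟨w, hw, rfl, hl⟩ := exists_word hT g
  obtain ⟨p, hp, hp'⟩ := exists_walk_of_chain hS (c := c) (fun i => x * φ (w.take i).prod) w.length
    (fun i hi => by
      rw [List.take_succ_eq_append_getElem hi, List.prod_append, map_mul]
      simp only [List.prod_singleton, mul_inv_rev]
      rw [show (φ (w.take i).prod)⁻¹ * x⁻¹ * (x * (φ (w.take i).prod * φ w[i])) = φ w[i] by group]
      rcases hw w[i] (by simp) with h | h
      · exact hc _ h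
      · rw [← wordLength_inv hS, ← map_inv]; exact hc _ h)
    (x := x) (y := y) (by simp) (by simpa using hy)
  refine ⟨p, hl ▸ hp, fun z hz => ?_⟩
  obtain ⟨i, -, hi⟩ := hp' z hz
  exact ⟨_, hi⟩

end WordLength

/-! ### Exponent sums in a right-angled Artin group -/

section RAAG

variable {V : Type*} {Γ : SimpleGraph V}

namespace RAAG

/-- The generator of the right-angled Artin group given by a vertex. -/
def gen (Γ : SimpleGraph V) (v : V) : RAAG Γ := PresentedGroup.of v

/-- The set of the standard generators. -/
def gens (Γ : SimpleGraph V) : Set (RAAG Γ) := Set.range (gen Γ)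

theorem closure_gens (Γ : SimpleGraph V) : Subgroup.closure (gens Γ) = ⊤ :=
  PresentedGroup.closure_range_of _

theorem finite_gens [Finite V] (Γ : SimpleGraph V) : (gens Γ).Finite := Set.finite_range _

theorem gen_mul_comm {s t : V} (h : Γ.Adj s t) : gen Γ s * gen Γ t = gen Γ t * gen Γ s := by
  have h1 : (PresentedGroup.mk _ (FreeGroup.of s * FreeGroup.of t * (FreeGroup.of s)⁻¹ *
      (FreeGroup.of t)⁻¹) : RAAG Γ) = 1 := PresentedGroup.one_of_mem ⟨s, t, h, rfl⟩
  simp only [map_mul, map_inv] at h1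
  have h2 : gen Γ s * gen Γ t * (gen Γ s)⁻¹ * (gen Γ t)⁻¹ = 1 := h1
  rwa [mul_inv_eq_one, mul_inv_eq_iff_eq_mul] at h2

/-- A homomorphism out of a right-angled Artin group, given on the vertices. -/
def lift {G : Type*} [Group G] (f : V → G) (hf : ∀ s t, Γ.Adj s t → f s * f t = f t * f s) :
    RAAG Γ →* G :=
  PresentedGroup.toGroup (f := f) (by
    rintro w ⟨s, t, h, rfl⟩
    simp [hf s t h])

@[simp]
theorem lift_gen {G : Type*} [Group G] (f : V → G)
    (hf : ∀ s t, Γ.Adj s t → f s * f t = f t * f s) (v : V) : lift f hf (gen Γ v) = f v :=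
  PresentedGroup.toGroup.of _

/-- The elements are reached from `1` by right multiplication by generators and their inverses. -/
theorem induction_right {p : RAAG Γ → Prop} (one : p 1) (mul : ∀ x v, p x → p (x * gen Γ v))
    (mul_inv : ∀ x v, p x → p (x * (gen Γ v)⁻¹)) (x : RAAG Γ) : p x := by
  have hx : x ∈ Subgroup.closure (gens Γ) := by rw [closure_gens]; trivial
  induction hx using Subgroup.closure_induction_right with
  | one => exact one
  | mul_right x hx y hy ih => obtain ⟨v, rfl⟩ := hy; exact mul _ _ ih
  | mul_inv_cancel x hx y hy ih => obtain ⟨v, rfl⟩ := hy; exact mul_inv _ _ ih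

open Classical in
/-- The exponent sum of the vertex `s`. -/
noncomputable def expSum (Γ : SimpleGraph V) (s : V) : RAAG Γ →* Multiplicative ℤ :=
  lift (fun v => Multiplicative.ofAdd (if v = s then 1 else 0)) fun _ _ _ => mul_comm _ _

theorem expSum_gen_self (s : V) : (expSum Γ s (gen Γ s)).toAdd = 1 := by simp [expSum]

theorem expSum_gen_of_ne {s v : V} (h : v ≠ s) : (expSum Γ s (gen Γ v)).toAdd = 0 := by
  simp [expSum, h]

theorem height_gen (v : V) : (raagHeight Γ (gen Γ v)).toAdd = 1 :=
  congrArg Multiplicative.toAdd (PresentedGroup.toGroup.of _)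

theorem height_eq_sum [Fintype V] (x : RAAG Γ) :
    (raagHeight Γ x).toAdd = ∑ s, (expSum Γ s x).toAdd := by
  classical
  have h (v : V) : ∑ s, (expSum Γ s (gen Γ v)).toAdd = 1 := by
    rw [Finset.sum_eq_single v (fun s _ hs => expSum_gen_of_ne (Ne.symm hs)) (by simp)]
    exact expSum_gen_self v
  induction x using induction_right with
  | one => simp
  | mul x v ih => simp [ih, Finset.sum_add_distrib, h, height_gen]
  | mul_inv x v ih => simp [ih, Finset.sum_add_distrib, h, height_gen]

theorem natAbs_expSum_le (s : V) (x : RAAG Γ) :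
    (expSum Γ s x).toAdd.natAbs ≤ wordLength (gens Γ) x := by
  have := natAbs_hom_le (closure_gens Γ) (expSum Γ s) (c := 1) (by
    rintro _ ⟨v, rfl⟩
    by_cases h : v = s
    · subst h; simp [expSum_gen_self]
    · simp [expSum_gen_of_ne h]) x
  simpa using this

theorem natAbs_height_le (x : RAAG Γ) :
    (raagHeight Γ x).toAdd.natAbs ≤ wordLength (gens Γ) x := by
  have := natAbs_hom_le (closure_gens Γ) (raagHeight Γ) (c := 1) (by
    rintro _ ⟨v, rfl⟩
    simp [height_gen]) x
  simpa using this

theorem mem_bestvinaBrady {x : RAAG Γ} : x ∈ bestvinaBrady Γ ↔ (raagHeight Γ x).toAdd = 0 :=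
  MonoidHom.mem_ker

/-! ### Half-spaces -/

/-- The subgroup generated by the vertices adjacent to `v`: the stabilizer of the hyperplane dual
to the edge from `1` to `v`. -/
def linkGroup (Γ : SimpleGraph V) (v : V) : Subgroup (RAAG Γ) :=
  Subgroup.closure (gen Γ '' Γ.neighborSet v)

/-- The subgroup generated by the vertices other than `v`. -/
def avoidGroup (Γ : SimpleGraph V) (v : V) : Subgroup (RAAG Γ) :=
  Subgroup.closure (gen Γ '' {v}ᶜ)

theorem linkGroup_le_avoidGroup {u v : V} (h : ¬ Γ.Adj u v) :
    linkGroup Γ u ≤ avoidGroup Γ v :=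
  Subgroup.closure_mono (Set.image_mono fun w hw hwv => h (by
    rw [Set.mem_singleton_iff] at hwv; exact hwv ▸ hw))

theorem gen_mem_avoidGroup {u v : V} (h : u ≠ v) : gen Γ u ∈ avoidGroup Γ v :=
  Subgroup.subset_closure ⟨u, h, rfl⟩

theorem gen_mul_comm_of_mem_linkGroup {v : V} {a : RAAG Γ} (ha : a ∈ linkGroup Γ v) :
    gen Γ v * a = a * gen Γ v := by
  have h : linkGroup Γ v ≤ Subgroup.centralizer {gen Γ v} := by
    rw [linkGroup, Subgroup.closure_le]
    rintro _ ⟨u, hu, rfl⟩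
    rw [SetLike.mem_coe, Subgroup.mem_centralizer_singleton_iff]
    exact gen_mul_comm (show Γ.Adj v u from hu).symm
  exact (Subgroup.mem_centralizer_singleton_iff.1 (h ha)).symm

theorem expSum_of_mem_avoidGroup {v : V} {a : RAAG Γ} (ha : a ∈ avoidGroup Γ v) :
    (expSum Γ v a).toAdd = 0 := by
  have h : avoidGroup Γ v ≤ (expSum Γ v).ker := by
    rw [avoidGroup, Subgroup.closure_le]
    rintro _ ⟨u, hu, rfl⟩
    exact expSum_gen_of_ne (Γ := Γ) hu
  exact h ha

open Classical in
/-- The affine action of the generator `s` on the integer-valued functions on the hyperplanes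
labelled `v` (the cosets of `linkGroup Γ v`): translation, followed, if `s = v`, by adding `1` at
the hyperplane dual to the edge from `1` to `v`. -/
noncomputable def crossingStep (Γ : SimpleGraph V) (v s : V) :
    Equiv.Perm (RAAG Γ ⧸ linkGroup Γ v → ℤ) where
  toFun F c := F ((gen Γ s)⁻¹ • c) +
    if s = v ∧ c = ((1 : RAAG Γ) : RAAG Γ ⧸ linkGroup Γ v) then 1 else 0
  invFun F c := F (gen Γ s • c) -
    if s = v ∧ gen Γ s • c = ((1 : RAAG Γ) : RAAG Γ ⧸ linkGroup Γ v) then 1 else 0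
  left_inv F := by ext c; simp
  right_inv F := by ext c; simp

theorem crossingStep_comm (v : V) {s t : V} (h : Γ.Adj s t) :
    crossingStep Γ v s * crossingStep Γ v t = crossingStep Γ v t * crossingStep Γ v s := by
  classical
  have key (s t : V) (hst : Γ.Adj s t) (c : RAAG Γ ⧸ linkGroup Γ v) :
      (s = v ∧ (gen Γ t)⁻¹ • c = ((1 : RAAG Γ) : RAAG Γ ⧸ linkGroup Γ v)) ↔
      (s = v ∧ c = ((1 : RAAG Γ) : RAAG Γ ⧸ linkGroup Γ v)) := by
    refine and_congr_right fun hs => ?_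
    subst hs
    rw [inv_smul_eq_iff]
    have : gen Γ t • ((1 : RAAG Γ) : RAAG Γ ⧸ linkGroup Γ s) =
        ((1 : RAAG Γ) : RAAG Γ ⧸ linkGroup Γ s) := by
      rw [MulAction.Quotient.smul_coe, eq_comm, QuotientGroup.eq, inv_one, one_mul, smul_eq_mul,
        mul_one]
      exact Subgroup.subset_closure (Set.mem_image_of_mem (gen Γ) hst)
    rw [this]
  ext F c
  have h1 : (gen Γ t)⁻¹ • (gen Γ s)⁻¹ • c = (gen Γ s)⁻¹ • (gen Γ t)⁻¹ • c := by
    rw [smul_smul, smul_smul, ← mul_inv_rev, ← mul_inv_rev, gen_mul_comm h]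
  simp only [Equiv.Perm.mul_apply, crossingStep, Equiv.coe_fn_mk, h1, key s t h c,
    key t s h.symm c]
  ring

/-- The affine action of the group on the integer-valued functions on the hyperplanes labelled
`v`. -/
noncomputable def crossingAction (Γ : SimpleGraph V) (v : V) :
    RAAG Γ →* Equiv.Perm (RAAG Γ ⧸ linkGroup Γ v → ℤ) :=
  lift (crossingStep Γ v) fun _ _ h => crossingStep_comm v h

/-- The signed number of times that a path from `1` to `x` crosses the hyperplane dual to the edge
from `1` to `v`. It is a coefficient of the Fox derivative of `x` with respect to `v`. -/
noncomputable def crossing (Γ : SimpleGraph V) (v : V) (x : RAAG Γ) : ℤ :=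
  crossingAction Γ v x 0 (1 : RAAG Γ)

theorem crossingAction_apply (v : V) (x : RAAG Γ) (F : RAAG Γ ⧸ linkGroup Γ v → ℤ)
    (c : RAAG Γ ⧸ linkGroup Γ v) :
    crossingAction Γ v x F c = crossingAction Γ v x 0 c + F (x⁻¹ • c) := by
  have hg (s : V) (F : RAAG Γ ⧸ linkGroup Γ v → ℤ) (c : RAAG Γ ⧸ linkGroup Γ v) :
      crossingStep Γ v s F c = crossingStep Γ v s 0 c + F ((gen Γ s)⁻¹ • c) := by
    simp only [crossingStep, Equiv.coe_fn_mk, Pi.zero_apply]; ring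
  have hg' (s : V) (F : RAAG Γ ⧸ linkGroup Γ v → ℤ) (c : RAAG Γ ⧸ linkGroup Γ v) :
      (crossingStep Γ v s)⁻¹ F c = (crossingStep Γ v s)⁻¹ 0 c + F (gen Γ s • c) := by
    simp only [crossingStep, Equiv.Perm.inv_def, Equiv.symm_mk, Equiv.coe_fn_mk, Pi.zero_apply]
    ring
  induction x using induction_right generalizing F c with
  | one => simp
  | mul x s ih =>
    simp only [map_mul, Equiv.Perm.mul_apply, crossingAction, lift_gen] at ih ⊢
    rw [ih, ih (crossingStep Γ v s 0), hg, mul_inv_rev, mul_smul]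
    ring
  | mul_inv x s ih =>
    simp only [map_mul, map_inv, Equiv.Perm.mul_apply, crossingAction, lift_gen] at ih ⊢
    rw [ih, ih ((crossingStep Γ v s)⁻¹ 0), hg', mul_inv_rev, mul_smul, inv_inv]
    ring

theorem crossing_one (v : V) : crossing Γ v 1 = 0 := by simp [crossing]

open Classical in
theorem crossing_mul_gen (v s : V) (x : RAAG Γ) :
    crossing Γ v (x * gen Γ s) =
      crossing Γ v x + if s = v ∧ x ∈ linkGroup Γ v then 1 else 0 := by
  rw [crossing, map_mul, Equiv.Perm.mul_apply, crossingAction_apply, ← crossing]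
  congr 1
  rw [crossingAction, lift_gen]
  simp only [crossingStep, Equiv.coe_fn_mk, Pi.zero_apply, zero_add]
  have : (x⁻¹ • ((1 : RAAG Γ) : RAAG Γ ⧸ linkGroup Γ v) = ((1 : RAAG Γ) : RAAG Γ ⧸ linkGroup Γ v)) ↔
      x ∈ linkGroup Γ v := by
    rw [MulAction.Quotient.smul_coe, QuotientGroup.eq]
    simp
  simp only [this]

theorem crossing_mul_gen_of_ne {v s : V} (h : s ≠ v) (x : RAAG Γ) :
    crossing Γ v (x * gen Γ s) = crossing Γ v x := by
  classical
  simp [crossing_mul_gen, h]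

theorem crossing_of_mem_avoidGroup {v : V} {x : RAAG Γ} (hx : x ∈ avoidGroup Γ v) :
    crossing Γ v x = 0 := by
  induction hx using Subgroup.closure_induction_right with
  | one => exact crossing_one v
  | mul_right x hx y hy ih =>
    obtain ⟨s, hs, rfl⟩ := hy
    rwa [crossing_mul_gen_of_ne hs]
  | mul_inv_cancel x hx y hy ih =>
    obtain ⟨s, hs, rfl⟩ := hy
    rwa [← crossing_mul_gen_of_ne hs, inv_mul_cancel_right]

/-- A letter: a generator (`true`) or the inverse of a generator (`false`). -/
def letter (Γ : SimpleGraph V) (l : V × Bool) : RAAG Γ :=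
  if l.2 then gen Γ l.1 else (gen Γ l.1)⁻¹

/-- The half-space of a letter: the side, not containing `1`, of the hyperplane dual to the edge
from `1` to the letter. -/
def halfSpace (Γ : SimpleGraph V) (l : V × Bool) : Set (RAAG Γ) :=
  if l.2 then {x | crossing Γ l.1 x = 1} else {x | crossing Γ l.1 (gen Γ l.1 * x) ≠ 1}

theorem crossing_gen (v : V) : crossing Γ v (gen Γ v) = 1 := by
  classical
  have := crossing_mul_gen (Γ := Γ) v v 1
  simpa [crossing_one, one_mem] using this

theorem one_notMem_halfSpace (l : V × Bool) : 1 ∉ halfSpace Γ l := by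
  obtain ⟨v, _ | _⟩ := l <;> simp [halfSpace, crossing_one, crossing_gen]

theorem letter_mem_halfSpace (l : V × Bool) : letter Γ l ∈ halfSpace Γ l := by
  obtain ⟨v, _ | _⟩ := l <;> simp [halfSpace, letter, crossing_one, crossing_gen]

/-- The Cayley graph with respect to the standard generators. -/
abbrev cayley (Γ : SimpleGraph V) : SimpleGraph (RAAG Γ) := SimpleGraph.mulCayley (gens Γ)

theorem cayley_adj_iff {x y : RAAG Γ} :
    (cayley Γ).Adj x y ↔ ∃ v, y = x * gen Γ v ∨ x = y * gen Γ v := by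
  have hne (x : RAAG Γ) (v : V) : x ≠ x * gen Γ v := fun h => by
    have := congrArg (fun x => (raagHeight Γ x).toAdd) h
    simp [height_gen] at this
  rw [SimpleGraph.mulCayley_adj']
  constructor
  · rintro ⟨-, _, ⟨v, rfl⟩, h | h⟩
    exacts [⟨v, Or.inl h.symm⟩, ⟨v, Or.inr h⟩]
  · rintro ⟨v, rfl | rfl⟩
    · exact ⟨hne _ _, _, ⟨v, rfl⟩, Or.inl rfl⟩
    · exact ⟨(hne _ _).symm, _, ⟨v, rfl⟩, Or.inr rfl⟩

theorem crossing_enter {v : V} {x y : RAAG Γ} (h : (cayley Γ).Adj x y)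
    (hx : crossing Γ v x ≠ 1) (hy : crossing Γ v y = 1) : x ∈ linkGroup Γ v ∧ y = x * gen Γ v := by
  classical
  obtain ⟨s, rfl | rfl⟩ := cayley_adj_iff.1 h
  · rw [crossing_mul_gen] at hy
    split_ifs at hy with h1
    · obtain ⟨rfl, h1⟩ := h1
      exact ⟨h1, rfl⟩
    · exact absurd (by simpa using hy) hx
  · rw [crossing_mul_gen] at hx
    split_ifs at hx with h1
    · obtain ⟨rfl, h1⟩ := h1
      have := crossing_of_mem_avoidGroup (linkGroup_le_avoidGroup (Γ.loopless.irrefl s) h1)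
      lia
    · exact absurd (by simpa using hy) hx

/-- The boundary of a half-space consists of the edges dual to its hyperplane. -/
theorem halfSpace_enter {l : V × Bool} {x y : RAAG Γ} (h : (cayley Γ).Adj x y)
    (hx : x ∉ halfSpace Γ l) (hy : y ∈ halfSpace Γ l) :
    x ∈ linkGroup Γ l.1 ∧ y = x * letter Γ l := by
  obtain ⟨v, _ | _⟩ := l
  · simp only [halfSpace, letter, Bool.false_eq_true, if_false, Set.mem_ofPred_eq, not_not] at *
    have h' : (cayley Γ).Adj (gen Γ v * y) (gen Γ v * x) :=
      SimpleGraph.mulCayley_adj_mul_iff_right.2 h.symm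
    obtain ⟨h1, h2⟩ := crossing_enter h' hy hx
    have h3 : x = y * gen Γ v := by rwa [mul_assoc, mul_right_inj] at h2
    have h4 := gen_mul_comm_of_mem_linkGroup h1
    rw [← h2, mul_right_inj] at h4
    exact ⟨h4 ▸ h1, by rw [h3]; simp⟩
  · simp only [halfSpace, letter, if_true, Set.mem_ofPred_eq] at *
    exact crossing_enter h hx hy

theorem mul_gen_mem_halfSpace_iff {l : V × Bool} {s : V} (hs : s ≠ l.1) (x : RAAG Γ) :
    x * gen Γ s ∈ halfSpace Γ l ↔ x ∈ halfSpace Γ l := by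
  obtain ⟨v, _ | _⟩ := l <;> simp [halfSpace, ← mul_assoc, crossing_mul_gen_of_ne hs]

theorem mul_mem_halfSpace_iff {l : V × Bool} {a : RAAG Γ} (ha : a ∈ avoidGroup Γ l.1)
    (x : RAAG Γ) : x * a ∈ halfSpace Γ l ↔ x ∈ halfSpace Γ l := by
  induction ha using Subgroup.closure_induction_right with
  | one => simp
  | mul_right a ha y hy ih =>
    obtain ⟨s, hs, rfl⟩ := hy
    rw [← mul_assoc, mul_gen_mem_halfSpace_iff hs, ih]
  | mul_inv_cancel a ha y hy ih =>
    obtain ⟨s, hs, rfl⟩ := hy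
    rw [← mul_gen_mem_halfSpace_iff hs, mul_assoc, inv_mul_cancel_right, ih]

theorem letter_mem_avoidGroup {l : V × Bool} {v : V} (h : l.1 ≠ v) :
    letter Γ l ∈ avoidGroup Γ v := by
  obtain ⟨u, _ | _⟩ := l
  · exact inv_mem (gen_mem_avoidGroup h)
  · exact gen_mem_avoidGroup h

theorem letter_inv_mem_avoidGroup {l : V × Bool} {v : V} (h : l.1 ≠ v) :
    (letter Γ l)⁻¹ ∈ avoidGroup Γ v := inv_mem (letter_mem_avoidGroup h)

/-- For two distinct letters whose vertices are not adjacent, the half-spaces that a path spelling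
the two letters enters are nested. -/
theorem halfSpace_nested {l l' : V × Bool} (hne : l.1 ≠ l'.1) (hadj : ¬ Γ.Adj l.1 l'.1)
    {x : RAAG Γ} (hx : x ∈ halfSpace Γ l') : letter Γ l * x ∈ halfSpace Γ l := by
  have step (x y : RAAG Γ) (h : (cayley Γ).Adj x y)
      (ih : x ∈ halfSpace Γ l' → letter Γ l * x ∈ halfSpace Γ l) (hy : y ∈ halfSpace Γ l') :
      letter Γ l * y ∈ halfSpace Γ l := by
    by_contra hly
    by_cases hx : x ∈ halfSpace Γ l'
    · -- the first hyperplane is crossed, at a point that is not beyond the second one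
      have h' : (cayley Γ).Adj (letter Γ l * y) (letter Γ l * x) :=
        SimpleGraph.mulCayley_adj_mul_iff_right.2 h.symm
      obtain ⟨h1, -⟩ := halfSpace_enter h' hly (ih hx)
      have h2 : (letter Γ l)⁻¹ * (letter Γ l * y) ∈ avoidGroup Γ l'.1 :=
        mul_mem (letter_inv_mem_avoidGroup hne) (linkGroup_le_avoidGroup hadj h1)
      rw [inv_mul_cancel_left] at h2
      rw [← one_mul y, mul_mem_halfSpace_iff h2] at hy
      exact one_notMem_halfSpace l' hy
    · -- the second hyperplane is crossed, at a point that is beyond the first one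
      obtain ⟨h1, rfl⟩ := halfSpace_enter h hx hy
      refine hly ((mul_mem_halfSpace_iff (mul_mem ?_ (letter_mem_avoidGroup hne.symm)) _).2
        (letter_mem_halfSpace l))
      exact linkGroup_le_avoidGroup (fun h => hadj h.symm) h1
  induction x using induction_right with
  | one => exact absurd hx (one_notMem_halfSpace l')
  | mul x v ih => exact step _ _ (cayley_adj_iff.2 ⟨v, Or.inl rfl⟩) ih hx
  | mul_inv x v ih => exact step _ _ (cayley_adj_iff.2 ⟨v, Or.inr (by simp)⟩) ih hx

end RAAG

end RAAG

/-! ### Detours around a long dipping geodesic -/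

section Detour

variable {V : Type*} {Γ : SimpleGraph V}

theorem compl_preconnected_of_not_isJoin (h : ¬ IsJoin Γ) : Γᶜ.Preconnected := by
  intro u v
  by_contra huv
  refine h ⟨{w | Γᶜ.Reachable u w}, ⟨u, .refl _⟩, ⟨v, huv⟩, fun a ha b hb => ?_⟩
  by_contra hab
  refine hb (SimpleGraph.Reachable.trans ha (SimpleGraph.Adj.reachable ?_))
  rw [SimpleGraph.compl_adj]
  exact ⟨fun hab => hb (hab ▸ ha), hab⟩

theorem SimpleGraph.Preconnected.exists_closed_walk {G : SimpleGraph V} (hG : G.Preconnected)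
    (v : V) (A : Finset V) : ∃ p : G.Walk v v, ∀ a ∈ A, a ∈ p.support := by
  classical
  induction A using Finset.induction_on with
  | empty => exact ⟨.nil, by simp⟩
  | insert a A _ ih =>
    obtain ⟨p, hp⟩ := ih
    obtain ⟨q⟩ := hG v a
    refine ⟨p.append (q.append q.reverse), fun b hb => ?_⟩
    rw [SimpleGraph.Walk.mem_support_append_iff, SimpleGraph.Walk.mem_support_append_iff]
    rcases Finset.mem_insert.1 hb with rfl | hb
    · exact Or.inr (Or.inl q.end_mem_support)
    · exact Or.inl (hp b hb)

/-- If `Γ` is not a join, some infinite sequence of vertices, consecutive terms of which are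
distinct and not adjacent, visits all the vertices in every window of a fixed length. -/
theorem exists_sequence_of_not_isJoin [Finite V] [Nontrivial V] (h : ¬ IsJoin Γ) :
    ∃ (z : ℕ → V) (k : ℕ), (∀ i, z i ≠ z (i + 1) ∧ ¬ Γ.Adj (z i) (z (i + 1))) ∧
      ∀ i s, ∃ j, i ≤ j ∧ j ≤ i + k ∧ z j = s := by
  have := Fintype.ofFinite V
  obtain ⟨u, v, huv⟩ := exists_pair_ne V
  obtain ⟨p, hp⟩ := (compl_preconnected_of_not_isJoin h).exists_closed_walk u Finset.univ
  have hn : 0 < p.length := by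
    by_contra hn
    have h1 := SimpleGraph.Walk.length_eq_zero_iff.1 (Nat.eq_zero_of_not_pos hn)
    have h2 := hp v (Finset.mem_univ _)
    rw [SimpleGraph.Walk.nil_iff_support_eq.1 h1] at h2
    exact huv (List.mem_singleton.1 h2).symm
  have hsucc (i : ℕ) : p.getVert ((i + 1) % p.length) = p.getVert (i % p.length + 1) := by
    rw [Nat.add_mod_eq_ite]
    have h1 := Nat.mod_lt i hn
    have h2 : 1 % p.length ≤ 1 := Nat.mod_le _ _
    rcases Nat.lt_or_ge 1 p.length with h3 | h3
    · rw [Nat.mod_eq_of_lt h3]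
      split_ifs with h4
      · rw [show i % p.length + 1 = p.length by lia]
        simp
      · rfl
    · have : p.length = 1 := by lia
      have h5 : p.getVert 1 = u := by rw [← this]; exact p.getVert_length
      simp [this, Nat.mod_one, h5]
  refine ⟨fun i => p.getVert (i % p.length), 2 * p.length, fun i => ?_, fun i s => ?_⟩
  · have := p.adj_getVert_succ (Nat.mod_lt i hn)
    rw [← hsucc, SimpleGraph.compl_adj] at this
    exact this
  · obtain ⟨j, hj, hjn⟩ := SimpleGraph.Walk.mem_support_iff_exists_getVert.1
      (hp s (Finset.mem_univ _))
    have hi := Nat.div_add_mod i p.length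
    have h1 := Nat.mod_lt i hn
    rcases hjn.lt_or_eq with h2 | h2
    · refine ⟨p.length * (i / p.length + 1) + j, by lia, by lia, ?_⟩
      simp only
      rw [Nat.mul_add_mod, Nat.mod_eq_of_lt h2, hj]
    · refine ⟨p.length * (i / p.length + 1), by lia, by lia, ?_⟩
      simp only
      rw [Nat.mul_mod_right, p.getVert_zero, ← hj, h2, p.getVert_length]

namespace RAAG

/-- The element spelled by the first `n` letters of a sequence. -/
def spell (Γ : SimpleGraph V) (l : ℕ → V × Bool) : ℕ → RAAG Γ
  | 0 => 1
  | n + 1 => spell Γ l n * letter Γ (l n)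

theorem wordLength_letter_le (l : V × Bool) : wordLength (gens Γ) (letter Γ l) ≤ 1 := by
  obtain ⟨v, _ | _⟩ := l
  · rw [letter, if_neg (by simp), wordLength_inv (closure_gens Γ)]
    exact wordLength_of_mem ⟨v, rfl⟩
  · exact wordLength_of_mem ⟨v, rfl⟩

theorem wordLength_spell_le (l : ℕ → V × Bool) (n : ℕ) :
    wordLength (gens Γ) (spell Γ l n) ≤ n := by
  induction n with
  | zero => simp [spell, wordLength_one]
  | succ n ih =>
    exact (wordLength_mul_le (closure_gens Γ) _ _).trans
      (Nat.add_le_add ih (wordLength_letter_le _))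

theorem natAbs_expSum_sub_le_of_adj (s : V) {x y : RAAG Γ} (h : (cayley Γ).Adj x y) :
    ((expSum Γ s y).toAdd - (expSum Γ s x).toAdd).natAbs ≤ 1 := by
  have := (natAbs_expSum_le s (x⁻¹ * y)).trans (wordLength_le_one_of_adj (closure_gens Γ) h)
  rwa [map_mul, map_inv, toAdd_mul, toAdd_inv, neg_add_eq_sub] at this

theorem natAbs_expSum_spell_sub_le (s : V) (l : ℕ → V × Bool) (i n : ℕ) :
    ((expSum Γ s (spell Γ l (i + n))).toAdd - (expSum Γ s (spell Γ l i)).toAdd).natAbs ≤ n := by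
  induction n with
  | zero => simp
  | succ n ih =>
    have h := (natAbs_expSum_le s _).trans (wordLength_letter_le (Γ := Γ) (l (i + n)))
    rw [← add_assoc, spell, map_mul, toAdd_mul]
    lia

theorem natAbs_expSum_path_sub_le (s : V) {X : ℕ → RAAG Γ} {N : ℕ}
    (hX : ∀ t < N, (cayley Γ).Adj (X t) (X (t + 1))) (i n : ℕ) (hn : i + n ≤ N) :
    ((expSum Γ s (X (i + n))).toAdd - (expSum Γ s (X i)).toAdd).natAbs ≤ n := by
  induction n with
  | zero => simp
  | succ n ih =>
    have h := natAbs_expSum_sub_le_of_adj s (hX (i + n) (by lia))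
    have := ih (by lia)
    rw [← add_assoc]
    lia

/-- The far side of the hyperplane dual to the edge that the `i`-th letter of a sequence spells. -/
def spellHalfSpace (Γ : SimpleGraph V) (l : ℕ → V × Bool) (i : ℕ) : Set (RAAG Γ) :=
  {x | (spell Γ l i)⁻¹ * x ∈ halfSpace Γ (l i)}

theorem spellHalfSpace_antitone {l : ℕ → V × Bool}
    (hl : ∀ i, (l i).1 ≠ (l (i + 1)).1 ∧ ¬ Γ.Adj (l i).1 (l (i + 1)).1) :
    Antitone (spellHalfSpace Γ l) := by
  refine antitone_nat_of_succ_le fun i x hx => ?_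
  have h := halfSpace_nested (hl i).1 (hl i).2 hx
  rw [spell, mul_inv_rev, mul_assoc, mul_inv_cancel_left] at h
  exact h

/-- A path from `1` to the element spelled by a sequence of letters, consecutive ones of which do
not commute, crosses the hyperplanes of the letters one after the other. -/
theorem exists_crossing_times {l : ℕ → V × Bool}
    (hl : ∀ i, (l i).1 ≠ (l (i + 1)).1 ∧ ¬ Γ.Adj (l i).1 (l (i + 1)).1)
    {X : ℕ → RAAG Γ} {N m : ℕ} (hX : ∀ t < N, (cayley Γ).Adj (X t) (X (t + 1)))
    (hX0 : X 0 = 1) (hXN : X N = spell Γ l m) :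
    ∃ τ : ℕ → ℕ, (∀ i < m, τ i < N ∧ ∃ a ∈ linkGroup Γ (l i).1, X (τ i) = spell Γ l i * a) ∧
      ∀ i j, i ≤ j → j < m → τ i ≤ τ j := by
  classical
  have hend (i : ℕ) (hi : i < m) : X N ∈ spellHalfSpace Γ l i := by
    refine spellHalfSpace_antitone hl (Nat.le_sub_one_of_lt hi) ?_
    obtain ⟨m, rfl⟩ : ∃ n, m = n + 1 := ⟨m - 1, by lia⟩
    rw [hXN, Nat.add_sub_cancel, spellHalfSpace, Set.mem_ofPred_eq, spell, inv_mul_cancel_left]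
    exact letter_mem_halfSpace _
  have hstart (i : ℕ) : X 0 ∉ spellHalfSpace Γ l i := fun h => by
    have := spellHalfSpace_antitone hl (Nat.zero_le i) h
    rw [hX0, spellHalfSpace, Set.mem_ofPred_eq, spell] at this
    exact one_notMem_halfSpace _ (by simpa using this)
  have hex (i : ℕ) (hi : i < m) : ∃ t, X t ∈ spellHalfSpace Γ l i := ⟨N, hend i hi⟩
  -- the `i`-th time is the last one before the path first enters the `i`-th half-space
  refine ⟨fun i => if hi : i < m then Nat.find (hex i hi) - 1 else 0, fun i hi => ?_,
    fun i j hij hj => ?_⟩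
  · have h1 := Nat.find_spec (hex i hi)
    have h2 : Nat.find (hex i hi) ≤ N := Nat.find_min' _ (hend i hi)
    have h3 : Nat.find (hex i hi) ≠ 0 := fun h0 => hstart i (h0 ▸ h1)
    obtain ⟨t, ht⟩ := Nat.exists_eq_succ_of_ne_zero h3
    have h4 : X t ∉ spellHalfSpace Γ l i := Nat.find_min (hex i hi) (by lia)
    rw [ht] at h1
    simp only [hi, dif_pos, ht, Nat.succ_sub_one]
    refine ⟨by lia, (spell Γ l i)⁻¹ * X t, ?_, by simp⟩
    exact (halfSpace_enter (SimpleGraph.mulCayley_adj_mul_iff_right.2 (hX t (by lia))) h4 h1).1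
  · have hi : i < m := by lia
    simp only [hi, hj, dif_pos]
    refine Nat.sub_le_sub_right (Nat.find_min' _ ?_) 1
    exact spellHalfSpace_antitone hl hij (Nat.find_spec (hex j hj))

/-- If `k` consecutive letters exhaust the vertices and start at depth at least `2 r`, a path that
stays above the depth `r` needs at least `r / |V| - k` steps to cross their hyperplanes: at the
first crossing some exponent sum is large, compared with the one at the geodesic, and when the
hyperplane of that vertex is crossed, it is not. -/
theorem le_crossing_times_sub [Fintype V] {l : ℕ → V × Bool} {k : ℕ}
    (hk : ∀ i s, ∃ j, i ≤ j ∧ j ≤ i + k ∧ (l j).1 = s)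
    {X : ℕ → RAAG Γ} {N m : ℕ} (hX : ∀ t < N, (cayley Γ).Adj (X t) (X (t + 1))) {τ : ℕ → ℕ}
    (hτ : ∀ i < m, τ i < N ∧ ∃ a ∈ linkGroup Γ (l i).1, X (τ i) = spell Γ l i * a)
    (hmono : ∀ i j, i ≤ j → j < m → τ i ≤ τ j) {r : ℕ}
    (hr : ∀ t ≤ N, 0 ≤ (raagHeight Γ (X t)).toAdd + r) {i : ℕ} (hi : i + k < m)
    (hdeep : (raagHeight Γ (spell Γ l i)).toAdd ≤ -(2 * r)) :
    r + Fintype.card V * τ i ≤ Fintype.card V * τ (i + k) + Fintype.card V * k := by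
  obtain ⟨hiN, a, ha, hXa⟩ := hτ i (by lia)
  have hha : (r : ℤ) ≤ (raagHeight Γ a).toAdd := by
    have := hr (τ i) hiN.le
    rw [hXa, map_mul, toAdd_mul] at this
    lia
  obtain ⟨s, hs⟩ : ∃ s, (r : ℤ) ≤ Fintype.card V * (expSum Γ s a).toAdd := by
    by_contra! hcon
    rcases isEmpty_or_nonempty V with hV | hV
    · exact hV.elim (l 0).1
    have h1 : ∑ s : V, Fintype.card V * (expSum Γ s a).toAdd < ∑ _s : V, (r : ℤ) :=
      Finset.sum_lt_sum_of_nonempty Finset.univ_nonempty fun s _ => hcon s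
    rw [← Finset.mul_sum, ← height_eq_sum, Finset.sum_const, Finset.card_univ, nsmul_eq_mul] at h1
    exact absurd h1 (not_lt.2 (mul_le_mul_of_nonneg_left hha (by positivity)))
  obtain ⟨j, hij, hjk, hj⟩ := hk i s
  obtain ⟨hjN, b, hb, hXb⟩ := hτ j (by lia)
  have hb0 : (expSum Γ s b).toAdd = 0 :=
    expSum_of_mem_avoidGroup (linkGroup_le_avoidGroup (by rw [hj]; exact Γ.loopless.irrefl s) hb)
  have hτij := hmono i j hij (by lia)
  have hτjk := hmono j (i + k) hjk hi
  have h1 := natAbs_expSum_spell_sub_le (Γ := Γ) s l i (j - i)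
  have h2 := natAbs_expSum_path_sub_le s hX (τ i) (τ j - τ i) (by lia)
  rw [Nat.add_sub_cancel' hij] at h1
  rw [Nat.add_sub_cancel' hτij, hXa, hXb, map_mul (expSum Γ s), map_mul (expSum Γ s), toAdd_mul,
    toAdd_mul, hb0] at h2
  have h3 : (expSum Γ s a).toAdd + τ i ≤ τ (i + k) + k := by lia
  have h4 : (Fintype.card V : ℤ) * ((expSum Γ s a).toAdd + τ i) ≤
      Fintype.card V * (τ (i + k) + k) := mul_le_mul_of_nonneg_left h3 (by positivity)
  have h5 : (r : ℤ) + Fintype.card V * τ i ≤ Fintype.card V * τ (i + k) + Fintype.card V * k := by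
    linarith
  exact_mod_cast h5

/-- If `Γ` is not a join, some elements of the Bestvina–Brady subgroup, of length linear in `r`,
are joined to `1` only by paths of length quadratic in `r` at the heights above `-r`. -/
theorem exists_long_detour [Finite V] [Nontrivial V] (h : ¬ IsJoin Γ) :
    ∃ C : ℕ, ∀ r : ℕ, ∃ g ∈ bestvinaBrady Γ, wordLength (gens Γ) g ≤ C * r ∧
      ∀ (x : RAAG Γ) (p : (cayley Γ).Walk x (x * g)),
        (∀ u ∈ p.support, (raagHeight Γ x).toAdd ≤ (raagHeight Γ u).toAdd + r) →
        r * r ≤ C * (p.length + r) := by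
  have := Fintype.ofFinite V
  obtain ⟨z, k, hz, hk⟩ := exists_sequence_of_not_isJoin h
  set q := Fintype.card V
  refine ⟨(4 + 2 * k) + q * (k + 1), fun r => ?_⟩
  -- the geodesic descends to the depth `m` and comes back; the part below the depth `2 r` is made
  -- of `r` blocks of `k` letters
  set m := 2 * r + r * k with hm
  set l : ℕ → V × Bool := fun i => (z i, decide (m ≤ i)) with hl
  have hdown (i : ℕ) (hi : i ≤ m) : (raagHeight Γ (spell Γ l i)).toAdd = -i := by
    induction i with
    | zero => simp [spell]
    | succ i ih =>
      have h1 : letter Γ (l i) = (gen Γ (z i))⁻¹ := by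
        rw [letter, if_neg (by simp [hl]; lia)]
      rw [spell, h1, map_mul, map_inv, toAdd_mul, toAdd_inv, height_gen, ih (by lia)]
      push_cast; ring
  have hup (i : ℕ) : (raagHeight Γ (spell Γ l (m + i))).toAdd = -m + i := by
    induction i with
    | zero => simpa using hdown m le_rfl
    | succ i ih =>
      have h1 : letter Γ (l (m + i)) = gen Γ (z (m + i)) := by
        rw [letter, if_pos (by simp [hl])]
      rw [← add_assoc, spell, h1, map_mul, toAdd_mul, height_gen, ih]
      push_cast; ring
  refine ⟨spell Γ l (m + m), ?_, ?_, fun x p hp => ?_⟩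
  · rw [mem_bestvinaBrady, hup]; ring
  · refine (wordLength_spell_le _ _).trans ?_
    rw [hm]
    nlinarith [Nat.zero_le (q * (k + 1) * r)]
  · set X : ℕ → RAAG Γ := fun t => x⁻¹ * p.getVert t
    have hX (t : ℕ) (ht : t < p.length) : (cayley Γ).Adj (X t) (X (t + 1)) :=
      SimpleGraph.mulCayley_adj_mul_iff_right.2 (p.adj_getVert_succ ht)
    obtain ⟨τ, hτ, hmono⟩ := exists_crossing_times (l := l) (m := m + m) hz hX
      (by simp [X]) (by simp [X])
    have hblock (b : ℕ) (hb : b ≤ r) (hr : 0 < r) :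
        b * r + q * τ (2 * r) ≤ q * τ (2 * r + b * k) + q * (b * k) := by
      induction b with
      | zero => simp
      | succ b ih =>
        have hbk : b * k + k ≤ r * k := by
          rw [← Nat.succ_mul]; exact Nat.mul_le_mul_right k hb
        have h1 := le_crossing_times_sub (k := k) (l := l) hk hX hτ hmono (r := r)
          (fun t _ => by
            have := hp _ (p.getVert_mem_support t)
            simp only [X, map_mul, map_inv, toAdd_mul, toAdd_inv]
            lia) (i := 2 * r + b * k) (by lia) (by
            rw [hdown _ (by lia)]; push_cast; nlinarith [Nat.zero_le (b * k)])
        have h2 := ih (by lia)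
        have h3 : 2 * r + (b + 1) * k = 2 * r + b * k + k := by ring
        rw [h3]
        change r + q * _ ≤ q * _ + q * k at h1
        nlinarith
    rcases Nat.eq_zero_or_pos r with rfl | hr
    · simp
    have h1 := hblock r le_rfl hr
    have h2 := (hτ (2 * r + r * k) (by lia)).1
    have h3 : q * τ (2 * r + r * k) ≤ q * p.length := Nat.mul_le_mul_left q h2.le
    calc r * r ≤ q * p.length + q * (r * k) := by lia
      _ ≤ _ := by
        have e : ((4 + 2 * k) + q * (k + 1)) * (p.length + r) =
          q * p.length + q * (r * k) +
            ((4 + 2 * k) * (p.length + r) + q * k * p.length + q * r) := by ring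
        rw [e]
        exact Nat.le_add_right _ _

end RAAG

end Detour

/-! ### Upper bounds for the distortion -/

section UpperDistortion

variable {V : Type*} {Γ : SimpleGraph V}

namespace RAAG

/-- `EdgeWord Γ n g`: the element `g` is a product of at most `n` elements `s * t⁻¹` given by the
oriented edges of `Γ`. -/
def EdgeWord (Γ : SimpleGraph V) (n : ℕ) (g : RAAG Γ) : Prop :=
  ∃ w : List (RAAG Γ), (∀ x ∈ w, ∃ s t, Γ.Adj s t ∧ x = gen Γ s * (gen Γ t)⁻¹) ∧ w.prod = g ∧
    w.length ≤ n

theorem EdgeWord.one (n : ℕ) : EdgeWord Γ n 1 := ⟨[], by simp⟩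

theorem EdgeWord.mul {m n : ℕ} {g h : RAAG Γ} (hg : EdgeWord Γ m g) (hh : EdgeWord Γ n h) :
    EdgeWord Γ (m + n) (g * h) := by
  obtain ⟨w, hw, rfl, hl⟩ := hg
  obtain ⟨w', hw', rfl, hl'⟩ := hh
  refine ⟨w ++ w', fun x hx => ?_, by simp, by simp; lia⟩
  rcases List.mem_append.1 hx with h | h
  exacts [hw x h, hw' x h]

theorem EdgeWord.mono {m n : ℕ} {g : RAAG Γ} (hg : EdgeWord Γ m g) (h : m ≤ n) :
    EdgeWord Γ n g := by
  obtain ⟨w, hw, hg, hl⟩ := hg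
  exact ⟨w, hw, hg, hl.trans h⟩

theorem EdgeWord.of_le_of_eq {m n : ℕ} {g g' : RAAG Γ} (hg : EdgeWord Γ m g) (h : m ≤ n)
    (h' : g = g') : EdgeWord Γ n g' := h' ▸ hg.mono h

theorem EdgeWord.of_adj {s t : V} (h : Γ.Adj s t) : EdgeWord Γ 1 (gen Γ s * (gen Γ t)⁻¹) :=
  ⟨[gen Γ s * (gen Γ t)⁻¹], by simpa using ⟨s, t, h, rfl⟩, by simp⟩

theorem EdgeWord.inv {n : ℕ} {g : RAAG Γ} (hg : EdgeWord Γ n g) : EdgeWord Γ n g⁻¹ := by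
  obtain ⟨w, hw, rfl, hl⟩ := hg
  refine ⟨(w.map (·⁻¹)).reverse, fun x hx => ?_, by rw [List.prod_inv_reverse], by simpa⟩
  obtain ⟨y, hy, rfl⟩ := List.mem_map.1 (List.mem_reverse.1 hx)
  obtain ⟨s, t, hst, rfl⟩ := hw y hy
  exact ⟨t, s, hst.symm, by simp⟩

theorem EdgeWord.pow {n : ℕ} {g : RAAG Γ} (hg : EdgeWord Γ n g) (m : ℕ) :
    EdgeWord Γ (m * n) (g ^ m) := by
  induction m with
  | zero => simpa using EdgeWord.one 0
  | succ m ih => rw [pow_succ, Nat.succ_mul]; exact ih.mul hg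

theorem EdgeWord.zpow {n : ℕ} {g : RAAG Γ} (hg : EdgeWord Γ n g) (m : ℤ) :
    EdgeWord Γ (m.natAbs * n) (g ^ m) := by
  obtain ⟨k, rfl | rfl⟩ := m.eq_nat_or_neg
  · simpa using hg.pow k
  · simpa using (hg.pow k).inv

theorem gen_zpow_mul_zpow {s t : V} (h : Γ.Adj s t) (n : ℤ) :
    gen Γ s ^ n * gen Γ t ^ (-n) = (gen Γ s * (gen Γ t)⁻¹) ^ n := by
  have hc : Commute (gen Γ s) (gen Γ t)⁻¹ := Commute.inv_right (gen_mul_comm h)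
  rw [hc.mul_zpow, inv_zpow']

theorem edgeWord_of_walk {s t : V} (p : Γ.Walk s t) (n : ℤ) :
    EdgeWord Γ (p.length * n.natAbs) (gen Γ s ^ n * gen Γ t ^ (-n)) := by
  induction p with
  | nil => simpa using EdgeWord.one 0
  | @cons s u t h p ih =>
    have h1 := ((EdgeWord.of_adj h).zpow n).mul ih
    rw [← gen_zpow_mul_zpow h] at h1
    convert h1 using 1
    · rw [SimpleGraph.Walk.length_cons]; ring
    · group

theorem exists_edgeWord_zpow [Finite V] (hΓ : Γ.Connected) (t : V) :
    ∃ d, ∀ s (n : ℤ), EdgeWord Γ (d * n.natAbs) (gen Γ t ^ n * gen Γ s ^ (-n)) := by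
  have p (s : V) : Γ.Walk t s := (hΓ.preconnected t s).some
  obtain ⟨d, hd⟩ := exists_bound_of_finite (Set.finite_univ (α := V)) fun s => (p s).length
  exact ⟨d, fun s n => (edgeWord_of_walk (p s) n).mono (Nat.mul_le_mul_right _ (hd s trivial))⟩

theorem natAbs_height_prod_le {w : List (RAAG Γ)} (hw : ∀ s ∈ w, s ∈ gens Γ ∨ s⁻¹ ∈ gens Γ) :
    (raagHeight Γ w.prod).toAdd.natAbs ≤ w.length :=
  (natAbs_height_le _).trans (wordLength_le_of_word hw)

/-- The elements of height `0` are quadratically short products of edges. In the prefix at height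
`n`, a letter `s` contributes `t ^ n * s * t ^ (-(n + 1))`, which is a product of linearly many
edges. -/
theorem exists_edgeWord_quadratic [Finite V] (hΓ : Γ.Connected) (t : V) :
    ∃ d, ∀ w : List (RAAG Γ), (∀ s ∈ w, s ∈ gens Γ ∨ s⁻¹ ∈ gens Γ) →
      EdgeWord Γ (d * (w.length * (w.length + 1)))
        (w.prod * gen Γ t ^ (-(raagHeight Γ w.prod).toAdd)) := by
  obtain ⟨d, hd⟩ := exists_edgeWord_zpow hΓ t
  have hstep (s : V) (n : ℤ) (m : ℕ) (h0 : n.natAbs ≤ m) (h1 : (n + 1).natAbs ≤ m + 1) :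
      EdgeWord Γ (d * (2 * m + 1)) (gen Γ t ^ n * gen Γ s * gen Γ t ^ (-(n + 1))) := by
    have h := (hd s n).mul (hd s (n + 1)).inv
    refine h.of_le_of_eq ?_ (by group)
    rw [← Nat.mul_add]
    exact Nat.mul_le_mul_left d (by lia)
  refine ⟨d, fun w => ?_⟩
  induction w using List.reverseRecOn with
  | nil => intro _; simpa using EdgeWord.one 0
  | append_singleton w x ih =>
    intro hw
    have hw' : ∀ s ∈ w, s ∈ gens Γ ∨ s⁻¹ ∈ gens Γ := fun s hs => hw s (by simp [hs])
    have ih := ih hw'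
    have hh := natAbs_height_prod_le hw'
    have hlen : (w ++ [x]).length = w.length + 1 := by simp
    rw [List.prod_append, List.prod_singleton, map_mul, toAdd_mul, hlen]
    generalize (raagHeight Γ w.prod).toAdd = n at ih hh ⊢
    rcases hw x (by simp) with ⟨s, rfl⟩ | ⟨s, hs⟩
    · have h := ih.mul (hstep s n w.length hh (by lia))
      refine h.of_le_of_eq ?_ ?_
      · rw [← Nat.mul_add]; exact Nat.mul_le_mul_left d (by nlinarith)
      · rw [height_gen]
        group
    · obtain rfl : x = (gen Γ s)⁻¹ := by rw [hs, inv_inv]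
      have h1 : EdgeWord Γ (d * (2 * w.length + 1)) _ :=
        ((hd s (n - 1)).mul (hd s n).inv).inv.mono
          (by rw [← Nat.mul_add]; exact Nat.mul_le_mul_left d (by lia))
      have h := ih.mul h1
      refine h.of_le_of_eq ?_ ?_
      · rw [← Nat.mul_add]; exact Nat.mul_le_mul_left d (by nlinarith)
      · rw [map_inv, toAdd_inv, height_gen]
        group

/-- In a join, an element is a product of one element from each factor, and in each factor the
letters can be compensated by a vertex of the other factor, with which they commute. -/
theorem exists_edgeWord_join {A : Set V} (hA : ∀ u ∈ A, ∀ v ∈ Aᶜ, Γ.Adj u v) {t u : V}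
    (ht : t ∈ A) (hu : u ∈ Aᶜ) (w : List (RAAG Γ)) (hw : ∀ s ∈ w, s ∈ gens Γ ∨ s⁻¹ ∈ gens Γ) :
    ∃ (α β : RAAG Γ) (a b : ℕ), a + b ≤ w.length ∧ w.prod = α * β ∧
      (∀ s ∈ Aᶜ, Commute α (gen Γ s)) ∧ (∀ s ∈ A, Commute β (gen Γ s)) ∧
      EdgeWord Γ a (α * gen Γ u ^ (-(raagHeight Γ α).toAdd)) ∧
      EdgeWord Γ b (gen Γ t ^ (-(raagHeight Γ β).toAdd) * β) ∧
      (raagHeight Γ α).toAdd.natAbs ≤ a := by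
  have hcomm {s s' : V} (hs : s ∈ A) (hs' : s' ∈ Aᶜ) : Commute (gen Γ s) (gen Γ s') :=
    gen_mul_comm (hA s hs s' hs')
  induction w using List.reverseRecOn with
  | nil =>
    exact ⟨1, 1, 0, 0, by simp, by simp, fun _ _ => .one_left _, fun _ _ => .one_left _,
      by simpa using EdgeWord.one 0, by simpa using EdgeWord.one 0, by simp⟩
  | append_singleton w x ih =>
    obtain ⟨α, β, a, b, hab, hprod, hα, hβ, hEα, hEβ, ha⟩ := ih fun s hs => hw s (by simp [hs])
    obtain ⟨s, e, he, hx⟩ : ∃ (s : V) (e : ℤ), e.natAbs = 1 ∧ x = gen Γ s ^ e := by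
      rcases hw x (by simp) with ⟨s, rfl⟩ | ⟨s, hs⟩
      · exact ⟨s, 1, by simp⟩
      · exact ⟨s, -1, by simp [hs]⟩
    have hhx : (raagHeight Γ x).toAdd = e := by
      rw [hx, map_zpow, toAdd_zpow, height_gen]; simp
    by_cases hs : s ∈ A
    · refine ⟨α * x, β, a + 1, b, by simp; lia, ?_, fun v hv => ?_, hβ, ?_, hEβ, ?_⟩
      · rw [List.prod_append, hprod, List.prod_singleton, mul_assoc, mul_assoc, hx,
          ((hβ s hs).zpow_right e).eq]
      · rw [hx]; exact (hα v hv).mul_left ((hcomm hs hv).zpow_left e)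
      · have h := hEα.mul ((EdgeWord.of_adj (hA s hs u hu)).zpow e)
        rw [he, one_mul] at h
        convert h using 1
        rw [← gen_zpow_mul_zpow (hA s hs u hu), map_mul, toAdd_mul, hhx, hx, mul_assoc, mul_assoc,
          ← mul_assoc (gen Γ u ^ _), ← ((hcomm hs hu).zpow_zpow e _).eq, mul_assoc, ← zpow_add,
          neg_add]
      · rw [map_mul, toAdd_mul, hhx]; lia
    · refine ⟨α, β * x, a, b + 1, by simp; lia, ?_, hα, fun v hv => ?_, hEα, ?_, ha⟩
      · rw [List.prod_append, hprod, List.prod_singleton, mul_assoc]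
      · rw [hx]; exact (hβ v hv).mul_left ((hcomm hv hs).symm.zpow_left e)
      · have h := hEβ.mul ((EdgeWord.of_adj (hA t ht s hs).symm).zpow e)
        rw [he, one_mul] at h
        convert h using 1
        rw [← gen_zpow_mul_zpow (hA t ht s hs).symm, map_mul, toAdd_mul, hhx, hx,
          ((hcomm ht hs).symm.zpow_zpow e _).eq, neg_add, zpow_add, mul_assoc, mul_assoc,
          ← mul_assoc β, ((hβ t ht).zpow_right (-e)).eq, mul_assoc]

/-- The elements `s * t⁻¹` of the Bestvina–Brady subgroup given by the oriented edges. -/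
def edgeGens (Γ : SimpleGraph V) : Set (bestvinaBrady Γ) :=
  {h | ∃ s t, Γ.Adj s t ∧ (h : RAAG Γ) = gen Γ s * (gen Γ t)⁻¹}

theorem finite_edgeGens [Finite V] (Γ : SimpleGraph V) : (edgeGens Γ).Finite := by
  refine Set.Finite.of_finite_image (f := Subtype.val) ?_ Subtype.val_injective.injOn
  refine (Set.finite_range fun p : V × V => gen Γ p.1 * (gen Γ p.2)⁻¹).subset ?_
  rintro _ ⟨h, ⟨s, t, -, hst⟩, rfl⟩
  exact ⟨(s, t), hst.symm⟩

theorem EdgeWord.exists_word {n : ℕ} {h : bestvinaBrady Γ} (hh : EdgeWord Γ n h) :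
    ∃ w : List (bestvinaBrady Γ), (∀ x ∈ w, x ∈ edgeGens Γ) ∧ w.prod = h ∧ w.length ≤ n := by
  obtain ⟨w, hw, hwh, hl⟩ := hh
  have hmem (x : RAAG Γ) (hx : x ∈ w) : x ∈ bestvinaBrady Γ := by
    obtain ⟨s, t, -, rfl⟩ := hw x hx
    rw [mem_bestvinaBrady]; simp [height_gen]
  lift w to List (bestvinaBrady Γ) using hmem
  refine ⟨w, fun x hx => hw x (List.mem_map_of_mem hx), Subtype.ext ?_, by simpa using hl⟩
  rw [← hwh]
  exact map_list_prod (bestvinaBrady Γ).subtype w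

theorem EdgeWord.wordLength_le {n : ℕ} {h : bestvinaBrady Γ} (hh : EdgeWord Γ n h) :
    wordLength (edgeGens Γ) h ≤ n := by
  obtain ⟨w, hw, rfl, hl⟩ := hh.exists_word
  exact (wordLength_le_of_word fun s hs => Or.inl (hw s hs)).trans hl

theorem exists_edgeWord_le_sq [Finite V] (hΓ : Γ.Connected) :
    ∃ C, ∀ h : bestvinaBrady Γ,
      EdgeWord Γ (C * wordLength (gens Γ) (h : RAAG Γ) ^ 2) (h : RAAG Γ) := by
  obtain ⟨t⟩ := hΓ.nonempty
  obtain ⟨d, hd⟩ := exists_edgeWord_quadratic hΓ t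
  refine ⟨2 * d, fun h => ?_⟩
  obtain ⟨w, hw, hwh, hl⟩ := _root_.exists_word (closure_gens Γ) (h : RAAG Γ)
  have h1 := hd w hw
  rw [hwh, mem_bestvinaBrady.1 h.2, neg_zero, zpow_zero, mul_one, hl] at h1
  refine h1.mono ?_
  rw [mul_comm 2 d, mul_assoc]
  exact Nat.mul_le_mul_left d (by
    nlinarith [Nat.le_self_pow two_ne_zero (wordLength (gens Γ) (h : RAAG Γ))])

theorem exists_edgeWord_le_of_isJoin (hΓ : IsJoin Γ) :
    ∃ C, ∀ h : bestvinaBrady Γ,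
      EdgeWord Γ (C * wordLength (gens Γ) (h : RAAG Γ) ^ 1) (h : RAAG Γ) := by
  obtain ⟨A, ⟨t, ht⟩, ⟨u, hu⟩, hA⟩ := hΓ
  refine ⟨2, fun h => ?_⟩
  obtain ⟨w, hw, hwh, hl⟩ := _root_.exists_word (closure_gens Γ) (h : RAAG Γ)
  obtain ⟨α, β, a, b, hab, hprod, hα, hβ, hEα, hEβ, ha⟩ := exists_edgeWord_join hA ht hu w hw
  have h0 : (raagHeight Γ β).toAdd = -(raagHeight Γ α).toAdd := by
    have := mem_bestvinaBrady.1 h.2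
    rw [← hwh, hprod, map_mul, toAdd_mul] at this
    lia
  have h1 := (hEα.mul ((EdgeWord.of_adj (hA t ht u hu).symm).zpow (raagHeight Γ α).toAdd)).mul hEβ
  rw [← gen_zpow_mul_zpow (hA t ht u hu).symm, h0, neg_neg] at h1
  refine h1.of_le_of_eq ?_ ?_
  · rw [← hl]; lia
  · rw [← hwh, hprod]
    group

theorem closure_edgeGens [Finite V] (hΓ : Γ.Connected) : Subgroup.closure (edgeGens Γ) = ⊤ := by
  rw [eq_top_iff]
  intro h _
  obtain ⟨C, hC⟩ := exists_edgeWord_le_sq hΓ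
  obtain ⟨w, hw, rfl, -⟩ := (hC h).exists_word
  exact list_prod_mem fun x hx => Subgroup.subset_closure (hw x hx)

/-- A bound for the lengths of the elements of the Bestvina–Brady subgroup as products of edges
gives one for arbitrary finite generating sets. -/
theorem exists_wordLength_le_pow [Finite V] (hΓ : Γ.Connected) {k : ℕ}
    (hk : ∃ C, ∀ h : bestvinaBrady Γ,
      EdgeWord Γ (C * wordLength (gens Γ) (h : RAAG Γ) ^ k) (h : RAAG Γ))
    {S : Set (RAAG Γ)} {T : Set (bestvinaBrady Γ)} (hS : S.Finite)
    (hS' : Subgroup.closure S = ⊤) (hT' : Subgroup.closure T = ⊤) :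
    ∃ C, ∀ h : bestvinaBrady Γ, wordLength T h ≤ C * wordLength S (h : RAAG Γ) ^ k := by
  obtain ⟨C, hC⟩ := hk
  obtain ⟨c, hc⟩ := exists_bound_of_finite hS (wordLength (gens Γ))
  obtain ⟨d, hd⟩ := exists_bound_of_finite (finite_edgeGens Γ) (wordLength T)
  refine ⟨d * (C * c ^ k), fun h => ?_⟩
  have h1 := wordLength_map_le hS' (closure_gens Γ) (MonoidHom.id _) hc (h : RAAG Γ)
  have h2 := wordLength_map_le (closure_edgeGens hΓ) hT' (MonoidHom.id _) hd h
  calc wordLength T h ≤ d * wordLength (edgeGens Γ) h := h2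
    _ ≤ d * (C * wordLength (gens Γ) (h : RAAG Γ) ^ k) := Nat.mul_le_mul_left d (hC h).wordLength_le
    _ ≤ d * (C * (c * wordLength S (h : RAAG Γ)) ^ k) := by gcongr; exact h1
    _ = _ := by rw [mul_pow]; ring

end RAAG

end UpperDistortion

/-! ### Length metrics -/

section LengthDist

open Set unitInterval

variable {X Y : Type*} [PseudoEMetricSpace X] [PseudoEMetricSpace Y]

theorem univ_inter_Icc_zero_one : (univ ∩ Icc (0 : I) 1) = univ := by
  ext t
  simp [le_one']

theorem lengthDist_le_eVariationOn {C : Set X} {x y : X} (γ : Path x y) (h : ∀ t, γ t ∈ C) :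
    lengthDist C x y ≤ eVariationOn γ univ :=
  iInf₂_le γ h

theorem exists_path_of_lengthDist_lt {C : Set X} {x y : X} {c : ℝ≥0∞} (h : lengthDist C x y < c) :
    ∃ γ : Path x y, (∀ t, γ t ∈ C) ∧ eVariationOn γ univ < c := by
  simp only [lengthDist, iInf_lt_iff] at h
  obtain ⟨γ, hγ, h⟩ := h
  exact ⟨γ, hγ, h⟩

theorem lengthDist_anti {C C' : Set X} (h : C ⊆ C') (x y : X) :
    lengthDist C' x y ≤ lengthDist C x y :=
  le_iInf₂ fun γ hγ => lengthDist_le_eVariationOn γ fun t => h (hγ t)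

theorem edist_le_lengthDist (C : Set X) (x y : X) : edist x y ≤ lengthDist C x y := by
  refine le_iInf₂ fun γ _ => ?_
  simpa using eVariationOn.edist_le γ (mem_univ (0 : I)) (mem_univ (1 : I))

theorem lengthDist_self {C : Set X} {x : X} (hx : x ∈ C) : lengthDist C x x = 0 := by
  refine le_antisymm ((lengthDist_le_eVariationOn (Path.refl x) fun _ => hx).trans_eq ?_) zero_le
  exact eVariationOn.constant_on (by rintro _ ⟨_, _, rfl⟩ _ ⟨_, _, rfl⟩; rfl)

theorem lengthDist_comm (C : Set X) (x y : X) : lengthDist C x y = lengthDist C y x := by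
  have key (x y : X) : lengthDist C x y ≤ lengthDist C y x := by
    refine le_iInf₂ fun γ hγ => (lengthDist_le_eVariationOn γ.symm fun t => hγ _).trans ?_
    exact eVariationOn.comp_le_of_antitoneOn γ σ
      (fun a _ b _ hab => by simpa using hab) (mapsTo_univ _ _)
  exact (key x y).antisymm (key y x)

theorem eVariationOn_trans_le {x y z : X} (γ : Path x y) (γ' : Path y z) :
    eVariationOn (γ.trans γ') univ ≤ eVariationOn γ univ + eVariationOn γ' univ := by
  have hhalf : (1 / 2 : ℝ) ∈ I := ⟨by norm_num, by norm_num⟩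
  set m : I := ⟨1 / 2, hhalf⟩
  have h := eVariationOn.Icc_add_Icc (γ.trans γ') (s := univ) (a := 0) (b := m) (c := 1)
    (Subtype.coe_le_coe.1 (by simp [m])) le_one' (mem_univ _)
  rw [univ_inter_Icc_zero_one] at h
  rw [← h]
  refine add_le_add ?_ ?_
  · refine (eVariationOn.congr
      (g := γ ∘ fun t : I => projIcc 0 1 zero_le_one (2 * (t : ℝ))) ?_).trans_le
      (eVariationOn.comp_le_of_monotoneOn γ _ ?_ (mapsTo_univ _ _))
    · rintro t ⟨-, -, ht⟩
      have ht : (t : ℝ) ≤ 1 / 2 := ht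
      rw [Path.trans_apply, dif_pos ht, Function.comp_apply, projIcc_of_mem]
    · exact fun a _ b _ hab => monotone_projIcc _ (by have : (a : ℝ) ≤ b := hab; linarith)
  · refine (eVariationOn.congr
      (g := γ' ∘ fun t : I => projIcc 0 1 zero_le_one (2 * (t : ℝ) - 1)) ?_).trans_le
      (eVariationOn.comp_le_of_monotoneOn γ' _ ?_ (mapsTo_univ _ _))
    · rintro t ⟨-, ht, -⟩
      have ht : 1 / 2 ≤ (t : ℝ) := ht
      rw [Path.trans_apply, Function.comp_apply]
      split_ifs with h
      · have h2 : (t : ℝ) = 1 / 2 := le_antisymm h ht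
        simp only [h2]
        norm_num
      · rw [projIcc_of_mem]
    · exact fun a _ b _ hab => monotone_projIcc _ (by have : (a : ℝ) ≤ b := hab; linarith)

theorem lengthDist_triangle (C : Set X) (x y z : X) :
    lengthDist C x z ≤ lengthDist C x y + lengthDist C y z := by
  refine ENNReal.le_of_forall_pos_le_add fun ε hε hlt => ?_
  rcases eq_or_ne (lengthDist C x y) ⊤ with h1 | h1
  · simp [h1]
  rcases eq_or_ne (lengthDist C y z) ⊤ with h2 | h2
  · simp [h2]
  have hε2 : (ε / 2 : ℝ≥0∞) ≠ 0 := by simpa using hε.ne'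
  obtain ⟨γ, hγ, h3⟩ := exists_path_of_lengthDist_lt (ENNReal.lt_add_right h1 hε2)
  obtain ⟨γ', hγ', h4⟩ := exists_path_of_lengthDist_lt (ENNReal.lt_add_right h2 hε2)
  refine (lengthDist_le_eVariationOn (γ.trans γ') fun t => ?_).trans
    ((eVariationOn_trans_le γ γ').trans ((add_le_add h3.le h4.le).trans_eq ?_))
  · rw [Path.trans_apply]
    split_ifs
    exacts [hγ _, hγ' _]
  · rw [add_add_add_comm, ENNReal.add_halves]

theorem lengthDist_le_of_isometry {C : Set X} {C' : Set Y} {f : X → Y} (hf : Isometry f)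
    (h : MapsTo f C C') (x y : X) : lengthDist C' (f x) (f y) ≤ lengthDist C x y := by
  refine le_iInf₂ fun γ hγ =>
    (lengthDist_le_eVariationOn (γ.map hf.continuous) fun t => h (hγ t)).trans (le_of_eq ?_)
  simp only [eVariationOn, Path.map_coe, Function.comp_apply, hf.edist_eq]

/-- The rest of a path after a time `t`. -/
theorem lengthDist_le_of_tail {C : Set X} {x y : X} (γ : Path x y) (t : I)
    (h : ∀ s, t ≤ s → γ s ∈ C) : lengthDist C (γ t) y ≤ eVariationOn γ univ := by
  let γ' : Path (γ t) y :=
    { toFun := fun s => γ (max t s)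
      continuous_toFun := γ.continuous.comp (continuous_const.max continuous_id)
      source' := by simp
      target' := by simp [le_one'] }
  refine (lengthDist_le_eVariationOn γ' fun s => h _ (le_max_left _ _)).trans ?_
  exact eVariationOn.comp_le_of_monotoneOn γ (fun s => max t s)
    (fun a _ b _ hab => max_le_max le_rfl hab) (mapsTo_univ _ _)

theorem lengthDist_le_of_lipschitz {C : Set X} {x y : X} (γ : Path x y) (hγ : LipschitzWith 1 γ)
    (h : ∀ t, γ t ∈ C) : lengthDist C x y ≤ 1 := by
  refine (lengthDist_le_eVariationOn γ h).trans ?_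
  have h1 := (hγ.lipschitzOnWith (s := univ)).comp_eVariationOn_le (f := γ)
    (mapsTo_univ (id : I → I) univ)
  have h2 : eVariationOn (fun t : I => (t : ℝ)) (univ ∩ Icc 0 1) = ENNReal.ofReal (1 - 0) :=
    MonotoneOn.eVariationOn_eq (f := fun t : I => (t : ℝ)) (fun a _ b _ hab => hab)
      (mem_univ _) (mem_univ _)
  rw [univ_inter_Icc_zero_one] at h2
  simp only [Function.comp_id, ENNReal.coe_one, one_mul] at h1
  rw [sub_zero, ENNReal.ofReal_one] at h2
  exact h1.trans h2.le

/-- On a set where a continuous function does not vanish, it has constant sign along paths. -/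
theorem pos_along_path {C : Set X} {f : X → ℝ} (hf : Continuous f) (hC : ∀ x ∈ C, f x ≠ 0)
    {x y : X} (γ : Path x y) (hγ : ∀ t, γ t ∈ C) (hx : 0 < f x) (t : I) : 0 < f (γ t) := by
  by_contra! h
  have h1 : (0 : ℝ) ∈ Icc (f (γ t)) (f (γ 0)) := ⟨h, by simpa using hx.le⟩
  obtain ⟨s, -, hs⟩ := isPreconnected_univ.intermediate_value (mem_univ t) (mem_univ (0 : I))
    (hf.comp γ.continuous).continuousOn h1
  exact hC _ (hγ s) hs

theorem lengthDist_inter_pos_le {C : Set X} {f : X → ℝ} (hf : Continuous f)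
    (hC : ∀ x ∈ C, f x ≠ 0) {x : X} (hx : 0 < f x) (y : X) :
    lengthDist (C ∩ {z | 0 < f z}) x y ≤ lengthDist C x y :=
  le_iInf₂ fun γ hγ =>
    lengthDist_le_eVariationOn γ fun t => ⟨hγ t, pos_along_path hf hC γ hγ hx t⟩

theorem exists_chain_of_eVariationOn_lt {C : Set X} {x y : X} (γ : Path x y) (hγ : ∀ t, γ t ∈ C)
    (n : ℕ) (t : I) (h : eVariationOn γ (univ ∩ Icc t 1) < n) :
    ∃ p : ℕ → X, p 0 = γ t ∧ p n = y ∧ (∀ i, p i ∈ C) ∧ ∀ i, edist (p i) (p (i + 1)) ≤ 1 := by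
  induction n generalizing t with
  | zero => simp at h
  | succ n ih =>
    by_cases hfar : ∃ s, t ≤ s ∧ 1 ≤ edist (γ t) (γ s)
    · obtain ⟨s, hts, hs⟩ := hfar
      have hcont : Continuous fun s => edist (γ t) (γ s) :=
        continuous_const.edist γ.continuous
      obtain ⟨s, ⟨hts, -⟩, hs⟩ := intermediate_value_Icc hts hcont.continuousOn
        (show (1 : ℝ≥0∞) ∈ Icc (edist (γ t) (γ t)) (edist (γ t) (γ s)) from ⟨by simp, hs⟩)
      have h1 := eVariationOn.Icc_add_Icc γ hts (le_one' (t := s)) (mem_univ s)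
      have h2 : (1 : ℝ≥0∞) ≤ eVariationOn γ (univ ∩ Icc t s) :=
        hs.symm.le.trans
          (eVariationOn.edist_le γ ⟨mem_univ _, le_rfl, hts⟩ ⟨mem_univ _, hts, le_rfl⟩)
      have h3 : 1 + eVariationOn γ (univ ∩ Icc s 1) < 1 + n := by
        refine (add_le_add_left h2 _).trans_lt ?_
        rw [h1, add_comm 1]
        exact_mod_cast h
      obtain ⟨p, hp0, hpn, hpC, hp⟩ := ih s ((ENNReal.add_lt_add_iff_left (by simp)).1 h3)
      refine ⟨fun i => Nat.casesOn i (γ t) p, rfl, hpn, fun i => ?_, fun i => ?_⟩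
      · cases i
        exacts [hγ t, hpC _]
      · cases i
        · change edist (γ t) (p 0) ≤ 1
          rw [hp0]
          exact hs.le
        · exact hp _
    · push Not at hfar
      refine ⟨fun i => Nat.casesOn i (γ t) fun _ => y, rfl, rfl, fun i => ?_, fun i => ?_⟩
      · cases i
        · exact hγ t
        · change y ∈ C
          rw [← γ.target]; exact hγ 1
      · cases i
        · change edist (γ t) y ≤ 1
          simpa using (hfar 1 le_one').le
        · change edist y y ≤ 1
          simp

/-- A path of length less than `n` can be subdivided into `n` steps of length at most `1`. -/
theorem exists_chain_of_lengthDist_lt {C : Set X} {x y : X} {n : ℕ} (h : lengthDist C x y < n) :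
    ∃ p : ℕ → X, p 0 = x ∧ p n = y ∧ (∀ i, p i ∈ C) ∧ ∀ i, edist (p i) (p (i + 1)) ≤ 1 := by
  obtain ⟨γ, hγ, h⟩ := exists_path_of_lengthDist_lt h
  rw [← univ_inter_Icc_zero_one] at h
  obtain ⟨p, hp0, hp⟩ := exists_chain_of_eVariationOn_lt γ hγ n 0 h
  exact ⟨p, by rw [hp0, γ.source], hp⟩

/-- On a path from a point of `A` to a point at distance at least `r`, the last point at distance
`r` from `A` is followed by points at distance at least `r` only. -/
theorem exists_last_mem_nbhdBoundary {A : Set X} {x y : X} {r : ℝ≥0} (γ : Path x y) (hx : x ∈ A)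
    (hy : r ≤ Metric.infEDist y A) :
    ∃ t, γ t ∈ nbhdBoundary A r ∧ ∀ s, t ≤ s → γ s ∈ (nbhd A r)ᶜ := by
  have hcont : Continuous fun s => Metric.infEDist (γ s) A :=
    Metric.continuous_infEDist.comp γ.continuous
  have hex (t : I) (ht : Metric.infEDist (γ t) A ≤ r) :
      ∃ s, t ≤ s ∧ Metric.infEDist (γ s) A = r := by
    obtain ⟨s, hs, h⟩ := intermediate_value_Icc (le_one' (t := t)) hcont.continuousOn
      (show (r : ℝ≥0∞) ∈ Icc (Metric.infEDist (γ t) A) (Metric.infEDist (γ 1) A) from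
        ⟨ht, by rwa [γ.target]⟩)
    exact ⟨s, hs.1, h⟩
  have hclosed : IsClosed {s | Metric.infEDist (γ s) A = r} := isClosed_eq hcont continuous_const
  obtain ⟨t, ht, hmax⟩ := hclosed.isCompact.exists_isGreatest (by
    obtain ⟨s, -, hs⟩ := hex 0 (by rw [γ.source, Metric.infEDist_zero_of_mem hx]; exact zero_le)
    exact ⟨s, hs⟩)
  refine ⟨t, ht, fun s hs hlt => ?_⟩
  obtain ⟨s', hs', h⟩ := hex s (le_of_lt hlt)
  have h1 : s = t := le_antisymm (hs'.trans (hmax h)) hs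
  rw [h1] at hlt
  exact absurd ht (ne_of_lt hlt)

end LengthDist

/-! ### Geometry of the realization of a graph -/

namespace Realization

open Set unitInterval

variable {V : Type*} {G : SimpleGraph V}

theorem edist_le_cellDist {x y : Realization G} (h : SameCell x y) : edist x y ≤ cellDist x y := by
  have h1 : PolyLength x y (cellDist x y + 0) := .cons h (.nil y)
  rw [add_zero] at h1
  exact sInf_le h1

theorem coords_mem_Icc {c : V →₀ ℝ} {u v : V} (h : c ∈ cellSet u v) (w : V) :
    c w ∈ Icc (0 : ℝ) 1 := by
  classical
  obtain ⟨a, b, ha, hb, hab, rfl⟩ := h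
  simp only [Finsupp.coe_add, Finsupp.coe_smul, Pi.add_apply, Pi.smul_apply, Finsupp.single_apply,
    smul_eq_mul]
  constructor <;> split_ifs <;> linarith

theorem cellDist_le_one {x y : Realization G} (h : SameCell x y) : cellDist x y ≤ 1 := by
  obtain ⟨u, v, -, hx, hy⟩ := h
  refine iSup_le fun w => ?_
  have h1 := coords_mem_Icc hx w
  have h2 := coords_mem_Icc hy w
  rw [edist_dist, Real.dist_eq, ← ENNReal.ofReal_one]
  exact ENNReal.ofReal_le_ofReal (abs_le.2 ⟨by linarith [h1.1, h2.2], by linarith [h1.2, h2.1]⟩)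

theorem edist_le_one {x y : Realization G} (h : SameCell x y) : edist x y ≤ 1 :=
  (edist_le_cellDist h).trans (cellDist_le_one h)

theorem sameCell_vertex {u v : V} (h : G.Adj u v) : SameCell (vertex G u) (vertex G v) :=
  ⟨u, v, Or.inr h, left_mem_segment ℝ _ _, right_mem_segment ℝ _ _⟩

theorem vertex_injective : Function.Injective (vertex G) := fun _ _ h =>
  Finsupp.single_left_injective one_ne_zero (congrArg coords h)

/-- A choice of a vertex of a cell containing the given point, which for a vertex is the vertex
itself. -/
theorem exists_nearVertex (G : SimpleGraph V) :
    ∃ f : Realization G → V, (∀ v, f (vertex G v) = v) ∧ ∀ x, SameCell x (vertex G (f x)) := by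
  have h (x : Realization G) : ∃ u, SameCell x (vertex G u) ∧ ∀ v, x = vertex G v → u = v := by
    by_cases hx : ∃ v, x = vertex G v
    · obtain ⟨v, rfl⟩ := hx
      exact ⟨v, ⟨v, v, Or.inl rfl, left_mem_segment ℝ _ _, left_mem_segment ℝ _ _⟩,
        fun w hw => vertex_injective hw⟩
    · obtain ⟨u, v, huv, hx'⟩ := x.mem_cell
      exact ⟨u, ⟨u, v, huv, hx', left_mem_segment ℝ _ _⟩, fun w hw => absurd ⟨w, hw⟩ hx⟩
  choose f hf hf' using h
  exact ⟨f, fun v => hf' _ v rfl, hf⟩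

/-! #### Affine extension of functions on the vertices -/

/-- The extension of a function on the vertices that is affine on the edges. -/
noncomputable def affineExtension (f : V → ℝ) (x : Realization G) : ℝ :=
  Finsupp.linearCombination ℝ f x.coords

@[simp]
theorem affineExtension_vertex (f : V → ℝ) (v : V) : affineExtension f (vertex G v) = f v := by
  simp [affineExtension, vertex]

theorem affineExtension_sub_le {f : V → ℝ} {κ : ℝ≥0}
    (hf : ∀ u v, G.Adj u v → |f u - f v| ≤ κ) {x y : Realization G} (h : SameCell x y) :
    edist (affineExtension f x) (affineExtension f y) ≤ κ * cellDist x y := by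
  classical
  obtain ⟨u, v, huv, ⟨a, b, -, -, hab, hx⟩, ⟨a', b', -, -, hab', hy⟩⟩ := h
  have hfx : affineExtension f x = a * f u + b * f v := by simp [affineExtension, ← hx]
  have hfy : affineExtension f y = a' * f u + b' * f v := by simp [affineExtension, ← hy]
  have hdiff : affineExtension f x - affineExtension f y = (a - a') * (f u - f v) := by
    rw [hfx, hfy, show b = 1 - a by linarith, show b' = 1 - a' by linarith]; ring
  rcases huv with rfl | huv
  · rw [sub_self, mul_zero, sub_eq_zero] at hdiff
    simp [hdiff]
  · have h1 : ENNReal.ofReal |a - a'| ≤ cellDist x y := by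
      refine le_trans (le_of_eq ?_) (le_iSup (fun w => edist (x.coords w) (y.coords w)) u)
      rw [edist_dist, Real.dist_eq, ← hx, ← hy]
      simp [huv.ne']
    rw [edist_dist, Real.dist_eq, hdiff, abs_mul, mul_comm, ENNReal.ofReal_mul (abs_nonneg _)]
    exact mul_le_mul' (by simpa using ENNReal.ofReal_le_ofReal (hf u v huv)) h1

theorem lipschitzWith_affineExtension {f : V → ℝ} {κ : ℝ≥0} (hκ : κ ≠ 0)
    (hf : ∀ u v, G.Adj u v → |f u - f v| ≤ κ) :
    LipschitzWith κ (affineExtension f : Realization G → ℝ) := by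
  have key {x y : Realization G} {c : ℝ≥0∞} (h : PolyLength x y c) :
      edist (affineExtension f x) (affineExtension f y) ≤ κ * c := by
    induction h with
    | nil x => simp
    | @cons x y z c hxy _ ih =>
      rw [mul_add]
      exact (edist_triangle _ _ _).trans (add_le_add (affineExtension_sub_le hf hxy) ih)
  intro x y
  change _ ≤ (κ : ℝ≥0∞) * sInf {c | PolyLength x y c}
  rw [sInf_eq_iInf', ENNReal.mul_iInf_of_ne (by simpa using hκ) (by simp)]
  exact le_iInf fun c => key c.2

/-! #### Paths -/

/-- The affine path between two points of a cell stays in the ball of radius `1` around the first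
one and has length at most `1`. -/
theorem lengthDist_le_one {C : Set (Realization G)} {x y : Realization G} (h : SameCell x y)
    (hC : ∀ z, edist x z ≤ 1 → z ∈ C) : lengthDist C x y ≤ 1 := by
  obtain ⟨u, v, huv, hx, hy⟩ := h
  have hmem (t : I) : (1 - (t : ℝ)) • x.coords + (t : ℝ) • y.coords ∈ cellSet u v :=
    (convex_segment _ _) hx hy (by linarith [t.2.2]) t.2.1 (by ring)
  let p (t : I) : Realization G :=
    ⟨(1 - (t : ℝ)) • x.coords + (t : ℝ) • y.coords, u, v, huv, hmem t⟩
  have hp : LipschitzWith 1 p := fun s t => by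
    rw [ENNReal.coe_one, one_mul]
    refine (edist_le_cellDist ⟨u, v, huv, hmem s, hmem t⟩).trans (iSup_le fun w => ?_)
    have h1 := coords_mem_Icc hx w
    have h2 := coords_mem_Icc hy w
    rw [Subtype.edist_eq, edist_dist, edist_dist, Real.dist_eq, Real.dist_eq]
    refine ENNReal.ofReal_le_ofReal ?_
    have h3 : (p s).coords w - (p t).coords w = (s - t : ℝ) * (y.coords w - x.coords w) := by
      simp only [p, Finsupp.coe_add, Finsupp.coe_smul, Pi.add_apply, Pi.smul_apply, smul_eq_mul]
      ring
    rw [h3, abs_mul]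
    exact mul_le_of_le_one_right (abs_nonneg _)
      (abs_le.2 ⟨by linarith [h1.2, h2.1], by linarith [h1.1, h2.2]⟩)
  let γ : Path x y :=
    { toFun := p
      continuous_toFun := hp.continuous
      source' := by ext; simp [p]
      target' := by ext; simp [p] }
  refine lengthDist_le_of_lipschitz γ hp fun t => hC _ ?_
  exact edist_le_one ⟨u, v, huv, hx, hmem t⟩

theorem lengthDist_le_length {C : Set (Realization G)} {u v : V} (p : G.Walk u v)
    (hC : ∀ w ∈ p.support, ∀ z, edist (vertex G w) z ≤ 1 → z ∈ C) :
    lengthDist C (vertex G u) (vertex G v) ≤ p.length := by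
  induction p with
  | @nil u => rw [lengthDist_self (hC u (by simp) _ (by simp))]; exact zero_le
  | @cons u v w h p ih =>
    refine (lengthDist_triangle C _ (vertex G v) _).trans ?_
    rw [SimpleGraph.Walk.length_cons, add_comm]
    push_cast
    exact add_le_add (ih fun w hw => hC w (by simp [hw]))
      (lengthDist_le_one (sameCell_vertex h) (hC u (by simp)))

theorem edist_vertex_le_length {u v : V} (p : G.Walk u v) :
    edist (vertex G u) (vertex G v) ≤ p.length :=
  (edist_le_lengthDist univ _ _).trans (lengthDist_le_length p fun _ _ _ _ => mem_univ _)

/-! #### Automorphisms -/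

/-- The map of the realization induced by an automorphism of the graph. -/
noncomputable def map (e : G ≃g G) (x : Realization G) : Realization G where
  coords := Finsupp.domLCongr (R := ℝ) e.toEquiv x.coords
  mem_cell := by
    obtain ⟨u, v, huv, a, b, ha, hb, hab, hx⟩ := x.mem_cell
    refine ⟨e u, e v, huv.imp (congrArg e) e.map_adj_iff.2, a, b, ha, hb, hab, ?_⟩
    rw [← hx, map_add, map_smul, map_smul, Finsupp.domLCongr_single, Finsupp.domLCongr_single]
    rfl

@[simp]
theorem map_vertex (e : G ≃g G) (v : V) : map e (vertex G v) = vertex G (e v) := by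
  ext1
  simp only [map, vertex, Finsupp.domLCongr_single]
  rfl

theorem map_symm_map (e : G ≃g G) (x : Realization G) : map e.symm (map e x) = x := by
  ext v
  simp [map, Finsupp.domLCongr_apply, Finsupp.domCongr_apply, Finsupp.equivMapDomain_apply]
  exact congrArg x.coords (e.symm_apply_apply v)

theorem SameCell.map (e : G ≃g G) {x y : Realization G} (h : SameCell x y) :
    SameCell (map e x) (map e y) := by
  obtain ⟨u, v, huv, ⟨a, b, ha, hb, hab, hx⟩, ⟨a', b', ha', hb', hab', hy⟩⟩ := h
  refine ⟨e u, e v, huv.imp (congrArg e) e.map_adj_iff.2, ⟨a, b, ha, hb, hab, ?_⟩,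
    ⟨a', b', ha', hb', hab', ?_⟩⟩
  · simp only [Realization.map, ← hx, map_add, map_smul, Finsupp.domLCongr_single]; rfl
  · simp only [Realization.map, ← hy, map_add, map_smul, Finsupp.domLCongr_single]; rfl

theorem cellDist_map_le (e : G ≃g G) (x y : Realization G) :
    cellDist (map e x) (map e y) ≤ cellDist x y := by
  refine iSup_le fun v => ?_
  refine le_trans (le_of_eq ?_) (le_iSup (fun w => edist (x.coords w) (y.coords w)) (e.symm v))
  rfl

theorem edist_map_le (e : G ≃g G) (x y : Realization G) :
    edist (map e x) (map e y) ≤ edist x y := by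
  have key {c : ℝ≥0∞} (h : PolyLength x y c) : edist (map e x) (map e y) ≤ c := by
    induction h with
    | nil x => simp
    | @cons x y z c hxy _ ih =>
      exact (edist_triangle _ _ _).trans
        (add_le_add ((edist_le_cellDist (hxy.map e)).trans (cellDist_map_le e x y)) ih)
  exact le_sInf fun c hc => key hc

theorem isometry_map (e : G ≃g G) : Isometry (map e) := fun x y => by
  refine (edist_map_le e x y).antisymm ?_
  have h := edist_map_le e.symm (map e x) (map e y)
  rwa [map_symm_map, map_symm_map] at h

end Realization

/-! ### The realization of a Cayley graph -/

section CayleyRealization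

variable {K : Type*} [Group K] {S : Set K}

open Realization

/-- Left multiplication, as an automorphism of the Cayley graph. -/
def mulLeftIso (S : Set K) (g : K) : SimpleGraph.mulCayley S ≃g SimpleGraph.mulCayley S where
  toEquiv := Equiv.mulLeft g
  map_rel_iff' := SimpleGraph.mulCayley_adj_mul_iff_right

theorem edist_vertex_le_wordLength (hS : Subgroup.closure S = ⊤) (x y : K) :
    edist (vertex (SimpleGraph.mulCayley S) x) (vertex _ y) ≤ wordLength S (x⁻¹ * y) := by
  obtain ⟨p, hp⟩ := exists_walk hS x y
  exact (edist_vertex_le_length p).trans (by exact_mod_cast hp)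

theorem wordLength_le_edist_vertex (hS : Subgroup.closure S = ⊤) (x y : K) :
    (wordLength S (x⁻¹ * y) : ℝ≥0∞) ≤ edist (vertex (SimpleGraph.mulCayley S) x) (vertex _ y) := by
  have h := lipschitzWith_affineExtension (G := SimpleGraph.mulCayley S) (κ := 1)
    one_ne_zero (f := fun z => (wordLength S (x⁻¹ * z) : ℝ)) (fun u v huv => by
      have h1 := wordLength_le_one_of_adj hS huv
      have h2 := wordLength_le_one_of_adj hS huv.symm
      have h3 := wordLength_mul_le hS (x⁻¹ * u) (u⁻¹ * v)
      have h4 := wordLength_mul_le hS (x⁻¹ * v) (v⁻¹ * u)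
      rw [show x⁻¹ * u * (u⁻¹ * v) = x⁻¹ * v by group] at h3
      rw [show x⁻¹ * v * (v⁻¹ * u) = x⁻¹ * u by group] at h4
      have h5 : (wordLength S (x⁻¹ * u) : ℝ) ≤ wordLength S (x⁻¹ * v) + 1 := by
        exact_mod_cast (by lia : wordLength S (x⁻¹ * u) ≤ wordLength S (x⁻¹ * v) + 1)
      have h6 : (wordLength S (x⁻¹ * v) : ℝ) ≤ wordLength S (x⁻¹ * u) + 1 := by
        exact_mod_cast (by lia : wordLength S (x⁻¹ * v) ≤ wordLength S (x⁻¹ * u) + 1)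
      rw [NNReal.coe_one]
      exact abs_le.2 ⟨by linarith, by linarith⟩) (vertex _ y) (vertex _ x)
  rw [affineExtension_vertex, affineExtension_vertex, inv_mul_cancel, wordLength_one, edist_dist,
    Real.dist_eq, ENNReal.coe_one, one_mul, edist_comm] at h
  simpa using h

end CayleyRealization

/-! ### The height on the realization of the Cayley graph -/

section HeightRealization

open Realization

variable {V : Type*} {Γ : SimpleGraph V} {S : Set (RAAG Γ)}

namespace RAAG

/-- The Bestvina–Brady subgroup, as a set of vertices of the Cayley graph. -/
abbrev baseSet (Γ : SimpleGraph V) (S : Set (RAAG Γ)) :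
    Set (Realization (SimpleGraph.mulCayley S)) :=
  vertex (SimpleGraph.mulCayley S) '' (bestvinaBrady Γ : Set (RAAG Γ))

/-- The height function, extended to the Cayley graph. -/
noncomputable def realHeight (Γ : SimpleGraph V) (S : Set (RAAG Γ)) :
    Realization (SimpleGraph.mulCayley S) → ℝ :=
  affineExtension fun x => ((raagHeight Γ x).toAdd : ℝ)

@[simp]
theorem realHeight_vertex (x : RAAG Γ) :
    realHeight Γ S (vertex _ x) = ((raagHeight Γ x).toAdd : ℝ) :=
  affineExtension_vertex _ _

theorem natAbs_height_sub_le (hS : Subgroup.closure S = ⊤) {κ : ℕ}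
    (hκ : ∀ s ∈ S, (raagHeight Γ s).toAdd.natAbs ≤ κ) (x y : RAAG Γ) :
    ((raagHeight Γ y).toAdd - (raagHeight Γ x).toAdd).natAbs ≤ κ * wordLength S (x⁻¹ * y) := by
  have h := natAbs_hom_le hS (raagHeight Γ) hκ (x⁻¹ * y)
  rwa [map_mul, map_inv, toAdd_mul, toAdd_inv, neg_add_eq_sub] at h

theorem lipschitzWith_realHeight (hS : Subgroup.closure S = ⊤) {κ : ℕ} (hκ0 : κ ≠ 0)
    (hκ : ∀ s ∈ S, (raagHeight Γ s).toAdd.natAbs ≤ κ) : LipschitzWith κ (realHeight Γ S) := by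
  refine lipschitzWith_affineExtension (by exact_mod_cast hκ0) fun u v huv => ?_
  have h1 := natAbs_height_sub_le hS hκ v u
  have h2 : κ * wordLength S (v⁻¹ * u) ≤ κ * 1 :=
    Nat.mul_le_mul_left κ (wordLength_le_one_of_adj hS huv.symm)
  have h3 : |(raagHeight Γ u).toAdd - (raagHeight Γ v).toAdd| ≤ (κ : ℤ) := by
    rw [Int.abs_eq_natAbs]; lia
  rw [NNReal.coe_natCast]
  exact_mod_cast h3

theorem abs_sub_le_of_lipschitzWith {X : Type*} [PseudoEMetricSpace X] {f : X → ℝ} {κ : ℕ}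
    (hf : LipschitzWith κ f) {x y : X} (h : edist x y ≤ 1) : |f x - f y| ≤ κ := by
  have h1 := (hf x y).trans (mul_le_mul_right h _)
  rw [edist_dist, Real.dist_eq, mul_one] at h1
  have := ENNReal.ofReal_le_iff_le_toReal (by simp) |>.1 h1
  simpa using this

/-- Points of large height are far from the Bestvina–Brady subgroup. -/
theorem mem_compl_nbhd {κ : ℕ} (hf : LipschitzWith κ (realHeight Γ S)) (hκ0 : κ ≠ 0) {r : ℝ≥0}
    {x : Realization (SimpleGraph.mulCayley S)} (h : κ * r ≤ |realHeight Γ S x|) :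
    x ∈ (nbhd (baseSet Γ S) r)ᶜ := by
  intro hx
  obtain ⟨_, ⟨a, ha, rfl⟩, hxa⟩ := Metric.infEDist_lt_iff.1 hx
  have h1 := hf x (vertex _ a)
  rw [realHeight_vertex, mem_bestvinaBrady.1 ha, edist_dist, Real.dist_eq, Int.cast_zero,
    sub_zero] at h1
  have h2 : (κ : ℝ≥0∞) * edist x (vertex _ a) < κ * r :=
    ENNReal.mul_lt_mul_right (by exact_mod_cast hκ0) (by simp) hxa
  have h3 : ENNReal.ofReal |realHeight Γ S x| < ENNReal.ofReal (κ * r) := by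
    refine (h1.trans_lt h2).trans_eq ?_
    rw [ENNReal.ofReal_mul (by positivity)]
    simp
  exact absurd h (not_le.2 (ENNReal.ofReal_lt_ofReal_iff_of_nonneg (abs_nonneg _) |>.1 h3))

/-- Points far from the Bestvina–Brady subgroup have large height. -/
theorem exists_le_abs_realHeight [Nonempty V] (hS : Subgroup.closure S = ⊤) {κ : ℕ}
    (hf : LipschitzWith κ (realHeight Γ S)) :
    ∃ c : ℕ, 1 ≤ c ∧ ∀ (r : ℝ≥0) (x : Realization (SimpleGraph.mulCayley S)),
      x ∈ (nbhd (baseSet Γ S) r)ᶜ → (r : ℝ) ≤ c * |realHeight Γ S x| + c := by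
  obtain ⟨t⟩ := ‹Nonempty V›
  obtain ⟨nv, -, hnv⟩ := exists_nearVertex (SimpleGraph.mulCayley S)
  set d := wordLength S (gen Γ t)
  refine ⟨d + κ * d + 1, by lia, fun r x hx => ?_⟩
  set v := nv x
  set j := (raagHeight Γ v).toAdd
  have hxv := edist_le_one (hnv x)
  have hmem : v * gen Γ t ^ (-j) ∈ bestvinaBrady Γ := by
    rw [mem_bestvinaBrady, map_mul, map_zpow, toAdd_mul, toAdd_zpow, height_gen]
    simp [j]
  have h1 : edist (vertex (SimpleGraph.mulCayley S) v) (vertex _ (v * gen Γ t ^ (-j))) ≤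
      ((j.natAbs * d : ℕ) : ℝ≥0∞) := by
    refine (edist_vertex_le_wordLength hS _ _).trans ?_
    rw [inv_mul_cancel_left]
    exact_mod_cast (wordLength_zpow_le hS (gen Γ t) (-j)).trans_eq (by rw [Int.natAbs_neg])
  have h2 : (r : ℝ≥0∞) ≤ ((1 + j.natAbs * d : ℕ) : ℝ≥0∞) := by
    have hr : (r : ℝ≥0∞) ≤ Metric.infEDist x (baseSet Γ S) := not_lt.1 fun h => hx h
    refine hr.trans ((Metric.infEDist_le_edist_of_mem (Set.mem_image_of_mem _ hmem)).trans
      ((edist_triangle _ _ _).trans ((add_le_add hxv h1).trans_eq ?_)))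
    push_cast; rfl
  have h3 : (r : ℝ) ≤ 1 + j.natAbs * d := by exact_mod_cast h2
  have h4 := abs_sub_le_of_lipschitzWith hf hxv
  rw [realHeight_vertex] at h4
  have h5 : (j.natAbs : ℝ) = |(j : ℝ)| := by rw [Nat.cast_natAbs]; simp
  have h6 : |(j : ℝ)| ≤ |realHeight Γ S x| + κ := by
    have := abs_sub_abs_le_abs_sub (j : ℝ) (realHeight Γ S x)
    rw [abs_sub_comm] at this
    linarith
  rw [h5] at h3
  push_cast
  have hd : (0 : ℝ) ≤ d := by positivity
  have hκd : (0 : ℝ) ≤ κ * d := by positivity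
  nlinarith [abs_nonneg (realHeight Γ S x), mul_le_mul_of_nonneg_right h6 hd,
    mul_nonneg hκd (abs_nonneg (realHeight Γ S x))]

theorem map_mulLeftIso_vertex (g a : RAAG Γ) :
    map (mulLeftIso S g) (vertex _ a) = vertex _ (g * a) :=
  map_vertex _ _

theorem infEDist_map {g : RAAG Γ} (hg : g ∈ bestvinaBrady Γ)
    (x : Realization (SimpleGraph.mulCayley S)) :
    Metric.infEDist (map (mulLeftIso S g) x) (baseSet Γ S) = Metric.infEDist x (baseSet Γ S) := by
  have h : map (mulLeftIso S g) '' baseSet Γ S = baseSet Γ S := by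
    rw [baseSet, Set.image_image]
    ext y
    constructor
    · rintro ⟨a, ha, rfl⟩
      exact ⟨g * a, mul_mem hg ha, (map_mulLeftIso_vertex g a).symm⟩
    · rintro ⟨a, ha, rfl⟩
      refine ⟨g⁻¹ * a, mul_mem (inv_mem hg) ha, ?_⟩
      exact (map_mulLeftIso_vertex _ _).trans (congrArg _ (mul_inv_cancel_left g a))
  conv_lhs => rw [← h]
  exact Metric.infEDist_image (isometry_map _)

/-! ### The divergence is bounded by the distortion -/

/-- Two elements on the same side of the Bestvina–Brady subgroup are joined by a path that does not
approach it much: powers of a generator lead to the height of the second element, and then one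
moves inside a coset. -/
theorem exists_high_walk [Nonempty V] (hS : Subgroup.closure S = ⊤) (hSfin : S.Finite)
    {T : Set (bestvinaBrady Γ)} (hT : Subgroup.closure T = ⊤) (hTfin : T.Finite) {k : ℕ}
    (hk : k ≠ 0)
    (hdist : ∃ C, ∀ h : bestvinaBrady Γ, wordLength T h ≤ C * wordLength S (h : RAAG Γ) ^ k) :
    ∃ B : ℕ, ∀ ε : ℤ, (ε = 1 ∨ ε = -1) → ∀ x y : RAAG Γ,
      ∃ p : (SimpleGraph.mulCayley S).Walk x y, p.length ≤ B * wordLength S (x⁻¹ * y) ^ k ∧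
        ∀ z ∈ p.support, min (ε * (raagHeight Γ x).toAdd) (ε * (raagHeight Γ y).toAdd) ≤
          ε * (raagHeight Γ z).toAdd + B := by
  obtain ⟨t⟩ := ‹Nonempty V›
  obtain ⟨C, hC⟩ := hdist
  obtain ⟨κ, hκ⟩ := exists_bound_of_finite hSfin fun s => (raagHeight Γ s).toAdd.natAbs
  obtain ⟨b, hb⟩ := exists_bound_of_finite hTfin fun h => wordLength S (h : RAAG Γ)
  set d := wordLength S (gen Γ t) with hd
  refine ⟨d * κ + b * (C * (d * κ + 1) ^ k) + κ * d + κ * b, fun ε hε x y => ?_⟩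
  set w := wordLength S (x⁻¹ * y)
  set j := (raagHeight Γ y).toAdd - (raagHeight Γ x).toAdd with hj
  have hjw : j.natAbs ≤ κ * w := natAbs_height_sub_le hS hκ x y
  obtain ⟨e, he, hej⟩ : ∃ e : ℤ, (e = 1 ∨ e = -1) ∧ j = e * j.natAbs := by
    rcases le_total 0 j with h | h
    · exact ⟨1, Or.inl rfl, by lia⟩
    · exact ⟨-1, Or.inr rfl, by lia⟩
  set u := x * gen Γ t ^ j with hu
  have hgen (n : ℤ) : (raagHeight Γ (x * gen Γ t ^ n)).toAdd = (raagHeight Γ x).toAdd + n := by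
    rw [map_mul, map_zpow, toAdd_mul, toAdd_zpow, height_gen]; simp
  have huy : u⁻¹ * y ∈ bestvinaBrady Γ := by
    rw [mem_bestvinaBrady, map_mul, map_inv, toAdd_mul, toAdd_inv, hgen]; lia
  have huw : wordLength S (u⁻¹ * y) ≤ (d * κ + 1) * w := by
    have h1 := wordLength_mul_le hS (gen Γ t ^ (-j)) (x⁻¹ * y)
    have h2 := wordLength_zpow_le hS (gen Γ t) (-j)
    rw [Int.natAbs_neg] at h2
    rw [show u⁻¹ * y = gen Γ t ^ (-j) * (x⁻¹ * y) by rw [hu]; group]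
    have h3 : j.natAbs * d ≤ κ * w * d := Nat.mul_le_mul_right d hjw
    rw [show (d * κ + 1) * w = κ * w * d + w by ring]
    lia
  obtain ⟨p, hp, hp'⟩ := exists_walk_of_chain hS (c := d) (fun i => x * gen Γ t ^ (e * (i : ℤ)))
    j.natAbs (fun i _ => by
      rw [show (x * gen Γ t ^ (e * (i : ℤ)))⁻¹ * (x * gen Γ t ^ (e * ((i + 1 : ℕ) : ℤ))) =
          gen Γ t ^ e by
        rw [mul_inv_rev, mul_assoc, inv_mul_cancel_left, ← zpow_neg, ← zpow_add]
        congr 1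
        push_cast
        ring]
      rcases he with rfl | rfl <;> simp [hd, wordLength_inv hS])
    (x := x) (y := u) (by simp) (by simp only [← hej, hu])
  obtain ⟨q, hq, hq'⟩ := exists_walk_of_map hT hS (bestvinaBrady Γ).subtype hb u
    y ⟨u⁻¹ * y, huy⟩ (by simp)
  have hw : w ≤ w ^ k := Nat.le_self_pow hk w
  refine ⟨p.append q, ?_, fun z hz => ?_⟩
  · rw [SimpleGraph.Walk.length_append]
    have h1 : d * j.natAbs ≤ d * κ * w ^ k := by
      rw [mul_assoc]
      exact Nat.mul_le_mul_left d (hjw.trans (Nat.mul_le_mul_left κ hw))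
    have h2 : b * wordLength T ⟨u⁻¹ * y, huy⟩ ≤ b * (C * (d * κ + 1) ^ k) * w ^ k := by
      refine (Nat.mul_le_mul_left b ((hC _).trans
        (Nat.mul_le_mul_left C (Nat.pow_le_pow_left huw k)))).trans_eq ?_
      rw [mul_pow]; ring
    have h3 : 0 ≤ (κ * d + κ * b) * w ^ k := Nat.zero_le _
    calc p.length + q.length ≤ d * κ * w ^ k + b * (C * (d * κ + 1) ^ k) * w ^ k := by lia
      _ ≤ _ := by rw [← add_mul]; exact Nat.mul_le_mul_right _ (by lia)
  · generalize hQ : b * (C * (d * κ + 1) ^ k) = Q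
    have hyx : (raagHeight Γ y).toAdd = (raagHeight Γ x).toAdd + e * j.natAbs := by lia
    rcases (SimpleGraph.Walk.mem_support_append_iff _ _).1 hz with h | h
    · obtain ⟨i, hi, hiz⟩ := hp' z h
      have h1 := (natAbs_height_sub_le hS hκ _ z).trans (Nat.mul_le_mul_left κ hiz)
      rw [hgen] at h1
      generalize (raagHeight Γ z).toAdd = a at h1 ⊢
      have hi : (i : ℤ) ≤ j.natAbs := by exact_mod_cast hi
      generalize (j.natAbs : ℤ) = n at hyx hi
      generalize κ * d = P at h1 ⊢
      generalize κ * b = R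
      generalize d * κ = P'
      rcases he with rfl | rfl <;> rcases hε with rfl | rfl <;> omega
    · obtain ⟨g', hg'⟩ := hq' z h
      have h1 := (natAbs_height_sub_le hS hκ _ z).trans (Nat.mul_le_mul_left κ hg')
      have h2 : (raagHeight Γ (u * (bestvinaBrady Γ).subtype g')).toAdd =
          (raagHeight Γ y).toAdd := by
        rw [map_mul, toAdd_mul, Subgroup.subtype_apply, mem_bestvinaBrady.1 g'.2, hgen]
        lia
      rw [h2] at h1
      generalize κ * d = P
      generalize κ * b = R at h1 ⊢
      generalize d * κ = P'
      rcases hε with rfl | rfl <;> omega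

end RAAG

end HeightRealization

section DivergenceBounds

open Realization

variable {V : Type*} {Γ : SimpleGraph V} {S : Set (RAAG Γ)}

namespace RAAG

theorem exists_height_constant (hSfin : S.Finite) :
    ∃ κ : ℕ, κ ≠ 0 ∧ ∀ s ∈ S, (raagHeight Γ s).toAdd.natAbs ≤ κ := by
  obtain ⟨κ, hκ⟩ := exists_bound_of_finite hSfin fun s => (raagHeight Γ s).toAdd.natAbs
  exact ⟨κ + 1, by lia, fun s hs => (hκ s hs).trans (by lia)⟩

/-- If the distortion is at most a multiple of `r ^ k`, so is the relative divergence. -/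
theorem exists_groupDivergence_le [Nonempty V] (hS : Subgroup.closure S = ⊤) (hSfin : S.Finite)
    {T : Set (bestvinaBrady Γ)} (hT : Subgroup.closure T = ⊤) (hTfin : T.Finite) {k : ℕ}
    (hk : k ≠ 0)
    (hdist : ∃ C, ∀ h : bestvinaBrady Γ, wordLength T h ≤ C * wordLength S (h : RAAG Γ) ^ k) :
    ∃ L : ℝ≥0, 0 < L ∧ L ≤ 1 ∧ ∀ n : ℕ, ∃ A D : ℝ≥0, ∀ ρ : ℝ≥0, ρ ≤ 1 → ∀ r : ℝ≥0, D < r →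
      groupDivergence S (bestvinaBrady Γ) n (L * ρ) r ≤ (A * r ^ k : ℝ≥0) := by
  obtain ⟨κ, hκ0, hκ⟩ := exists_height_constant hSfin
  have hf := lipschitzWith_realHeight hS hκ0 hκ
  obtain ⟨c, hc1, hc⟩ := exists_le_abs_realHeight hS hf
  obtain ⟨B, hB⟩ := exists_high_walk hS hSfin hT hTfin hk hdist
  obtain ⟨nv, -, hnv⟩ := exists_nearVertex (SimpleGraph.mulCayley S)
  have hcR : (1 : ℝ) ≤ c := by exact_mod_cast hc1
  have hκR : (1 : ℝ) ≤ κ := by exact_mod_cast Nat.one_le_iff_ne_zero.2 hκ0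
  refine ⟨(2 * c * κ : ℝ≥0)⁻¹, by positivity, ?_, fun n =>
    ⟨2 + B * (n + 2) ^ k, 2 * c * (1 + 2 * κ + B) + 1, fun ρ hρ r hr => ?_⟩⟩
  · refine inv_le_one_of_one_le₀ ?_
    have h1 : (1 : ℝ≥0) ≤ c := by exact_mod_cast hc1
    have h2 : (1 : ℝ≥0) ≤ κ := by exact_mod_cast Nat.one_le_iff_ne_zero.2 hκ0
    calc (1 : ℝ≥0) = 1 * 1 * 1 := by norm_num
      _ ≤ 2 * c * κ := by gcongr; norm_num
  have hrR : 2 * c * (1 + 2 * κ + B) + 1 < (r : ℝ) := by exact_mod_cast hr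
  have hBR : (0 : ℝ) ≤ B := by positivity
  have hr1 : (1 : ℝ) ≤ r := by
    nlinarith [mul_nonneg (by linarith : (0 : ℝ) ≤ c) (by linarith : (0 : ℝ) ≤ 1 + 2 * κ + B)]
  have hcr : (c : ℝ) < r := by nlinarith
  refine iSup_le fun x₁ => iSup_le fun x₂ => iSup_le fun h₁ => iSup_le fun h₂ => iSup_le fun hfin =>
    iSup_le fun hd => ?_
  -- the height does not vanish at distance `r`, so that both points are on the same side
  have hne : ∀ x ∈ (nbhd (baseSet Γ S) r)ᶜ, realHeight Γ S x ≠ 0 := fun x hx h0 => by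
    have := hc r x hx
    rw [h0, abs_zero] at this
    linarith
  have hmem {x} (hx : x ∈ nbhdBoundary (baseSet Γ S) r) : x ∈ (nbhd (baseSet Γ S) r)ᶜ :=
    fun h => absurd hx (ne_of_lt h)
  obtain ⟨ε, hε, hε₁, hε₂⟩ : ∃ ε : ℤ, (ε = 1 ∨ ε = -1) ∧
      |realHeight Γ S x₁| = ε * realHeight Γ S x₁ ∧
      |realHeight Γ S x₂| = ε * realHeight Γ S x₂ := by
    obtain ⟨γ, hγ, -⟩ := exists_path_of_lengthDist_lt hfin
    rcases lt_or_gt_of_ne (hne x₁ (hmem h₁)) with h | h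
    · have h' := pos_along_path hf.continuous.neg (fun x hx => neg_ne_zero.2 (hne x hx)) γ hγ
        (neg_pos.2 h) 1
      rw [γ.target] at h'
      replace h' := neg_pos.1 (show 0 < -realHeight Γ S x₂ from h')
      exact ⟨-1, Or.inr rfl, by simp [abs_of_neg h], by simp [abs_of_neg h']⟩
    · have h' := pos_along_path hf.continuous hne γ hγ h 1
      simp only [γ.target] at h'
      exact ⟨1, Or.inl rfl, by simp [abs_of_pos h], by simp [abs_of_pos h']⟩
  have hεabs (a : ℝ) : ε * a ≤ |a| := by
    rcases hε with rfl | rfl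
    · simpa using le_abs_self a
    · simpa using neg_le_abs a
  have hεsub {x y} (h : edist x y ≤ 1) : ε * realHeight Γ S x - κ ≤ (ε : ℝ) * realHeight Γ S y := by
    have h1 := hεabs (realHeight Γ S x - realHeight Γ S y)
    have h2 := abs_sub_le_of_lipschitzWith hf h
    rw [mul_sub] at h1
    linarith
  have hlow {x} (hx : x ∈ nbhdBoundary (baseSet Γ S) r)
      (hxε : |realHeight Γ S x| = (ε : ℝ) * realHeight Γ S x) :
      (r : ℝ) / c - 1 ≤ (ε : ℝ) * realHeight Γ S x := by
    have h1 := hc r x (hmem hx)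
    rw [hxε] at h1
    rw [sub_le_iff_le_add, div_le_iff₀ (by linarith)]
    linarith
  have hhigh {z} (hz : (r : ℝ) / (2 * c) ≤ (ε : ℝ) * realHeight Γ S z) :
      z ∈ (nbhd (baseSet Γ S) ((2 * c * κ : ℝ≥0)⁻¹ * ρ * r))ᶜ := by
    refine mem_compl_nbhd hf hκ0 (le_trans ?_ (hz.trans (hεabs _)))
    have hρR : (ρ : ℝ) ≤ 1 := by exact_mod_cast hρ
    push_cast
    rw [show (κ : ℝ) * ((2 * (c : ℝ) * κ)⁻¹ * ρ * r) = (r : ℝ) / (2 * c) * ρ by field_simp]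
    exact mul_le_of_le_one_right (by positivity) hρR
  have hroom : (r : ℝ) / (2 * c) ≤ (r : ℝ) / c - 1 - 2 * κ - B := by
    have : (r : ℝ) / c - (r : ℝ) / (2 * c) = (r : ℝ) / (2 * c) := by field_simp; ring
    have h2 : 1 + 2 * κ + B ≤ (r : ℝ) / (2 * c) := by
      rw [le_div_iff₀ (by linarith)]; linarith
    linarith
  set C := (nbhd (baseSet Γ S) ((2 * c * κ : ℝ≥0)⁻¹ * ρ * r))ᶜ
  have hv₁ := hnv x₁
  have hv₂ := hnv x₂
  set v₁ := nv x₁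
  set v₂ := nv x₂
  obtain ⟨p, hp, hp'⟩ := hB ε hε v₁ v₂
  have hvlow {x v} (hxv : SameCell x (vertex _ v))
      (hx : (r : ℝ) / c - 1 ≤ (ε : ℝ) * realHeight Γ S x) :
      (r : ℝ) / c - 1 - κ ≤ (ε : ℝ) * ((raagHeight Γ v).toAdd : ℝ) := by
    have h1 := hεsub (edist_le_one hxv)
    rw [realHeight_vertex] at h1
    linarith
  have e1 : lengthDist C x₁ (vertex _ v₁) ≤ 1 := lengthDist_le_one hv₁ fun z hz => hhigh (by
    have := hεsub hz
    have := hlow h₁ hε₁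
    linarith)
  have e2 : lengthDist C (vertex _ v₂) x₂ ≤ 1 := by
    rw [lengthDist_comm]
    exact lengthDist_le_one hv₂ fun z hz => hhigh (by
      have := hεsub hz
      have := hlow h₂ hε₂
      linarith)
  have e3 : lengthDist C (vertex _ v₁) (vertex _ v₂) ≤ p.length :=
    lengthDist_le_length p fun w hw z hz => hhigh (by
      have h1 := hεsub hz
      rw [realHeight_vertex] at h1
      have h2 : min (ε * ((raagHeight Γ v₁).toAdd : ℝ)) (ε * ((raagHeight Γ v₂).toAdd : ℝ)) ≤
          ε * ((raagHeight Γ w).toAdd : ℝ) + B := by exact_mod_cast hp' w hw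
      have h3 := le_min (hvlow hv₁ (hlow h₁ hε₁)) (hvlow hv₂ (hlow h₂ hε₂))
      linarith)
  have hw : (wordLength S (v₁⁻¹ * v₂) : ℝ≥0) ≤ (n + 2) * r := by
    have h1 : (wordLength S (v₁⁻¹ * v₂) : ℝ≥0∞) ≤ 1 + n * r + 1 := by
      refine (wordLength_le_edist_vertex hS v₁ v₂).trans ((edist_triangle4 _ x₁ x₂ _).trans ?_)
      gcongr
      · rw [edist_comm]; exact edist_le_one hv₁
      · exact edist_le_one hv₂
    have h2 : (wordLength S (v₁⁻¹ * v₂) : ℝ≥0) ≤ 1 + n * r + 1 := by exact_mod_cast h1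
    have h3 : (1 : ℝ≥0) ≤ r := by exact_mod_cast hr1
    calc (wordLength S (v₁⁻¹ * v₂) : ℝ≥0) ≤ 1 + n * r + 1 := h2
      _ ≤ r + n * r + r := by gcongr
      _ = _ := by ring
  have hlen : (p.length : ℝ≥0) ≤ B * ((n + 2) * r) ^ k := by
    calc (p.length : ℝ≥0) ≤ (B * wordLength S (v₁⁻¹ * v₂) ^ k : ℕ) := by exact_mod_cast hp
      _ = B * (wordLength S (v₁⁻¹ * v₂) : ℝ≥0) ^ k := by push_cast; rfl
      _ ≤ _ := by gcongr
  calc lengthDist C x₁ x₂ ≤ 1 + p.length + 1 :=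
        (lengthDist_triangle C _ (vertex _ v₂) _).trans
          (add_le_add ((lengthDist_triangle C _ (vertex _ v₁) _).trans (add_le_add e1 e3)) e2)
    _ = ((1 + p.length + 1 : ℝ≥0) : ℝ≥0∞) := by push_cast; rfl
    _ ≤ _ := by
      refine ENNReal.coe_le_coe.2 ?_
      have h3 : (1 : ℝ≥0) ≤ r ^ k := one_le_pow₀ (by exact_mod_cast hr1)
      calc (1 + p.length + 1 : ℝ≥0) ≤ r ^ k + B * ((n + 2) * r) ^ k + r ^ k := by gcongr
        _ = _ := by rw [mul_pow]; ring

/-! ### Lower bounds -/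

/-- If `Γ` is not a join, the distortion is at least quadratic. -/
theorem exists_sq_le_distortion [Finite V] [Nontrivial V] (h : ¬ IsJoin Γ)
    (hS : Subgroup.closure S = ⊤) {T : Set (bestvinaBrady Γ)}
    (hT : Subgroup.closure T = ⊤) (hTfin : T.Finite) :
    ∃ A D : ℝ≥0, ∀ r : ℝ≥0, D < r →
      (r ^ 2 : ℝ≥0) ≤ A * distortion S (bestvinaBrady Γ) T r + A * r := by
  obtain ⟨C, hC⟩ := exists_long_detour h
  obtain ⟨b, hb⟩ := exists_bound_of_finite hTfin fun t => wordLength (gens Γ) (t : RAAG Γ)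
  obtain ⟨c, hc⟩ := exists_bound_of_finite (finite_gens Γ) (wordLength S)
  -- the element of `exists_long_detour` for the depth `m` has length at most `E * m`
  set E := c * C + 1 with hE
  refine ⟨4 * E ^ 2 * C * (b + 1), E * (b + 1), fun r hr => ?_⟩
  have hE0 : (0 : ℝ≥0) < E := by simp [hE]
  set m := ⌊r / E⌋₊
  have hm : (m : ℝ≥0) ≤ r / E := Nat.floor_le zero_le
  have hm' : r / E < m + 1 := Nat.lt_floor_add_one _
  have hbm : b + 1 ≤ m := by
    refine Nat.le_floor ?_
    rw [le_div_iff₀ hE0, mul_comm]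
    push_cast
    exact hr.le
  obtain ⟨g, hg, hgl, hdet⟩ := hC m
  obtain ⟨p, hp, hp'⟩ := exists_walk_of_map hT (closure_gens Γ) (bestvinaBrady Γ).subtype hb 1
    (1 * g) ⟨g, hg⟩ (by simp)
  -- the walk stays `b`-close to the Bestvina–Brady subgroup, and `b < m`
  have h1 := hdet 1 p fun u hu => by
    obtain ⟨g', hg'⟩ := hp' u hu
    have h2 := (natAbs_height_le ((1 * (bestvinaBrady Γ).subtype g')⁻¹ * u)).trans hg'
    rw [map_mul (raagHeight Γ), map_inv, map_mul (raagHeight Γ), toAdd_mul, toAdd_inv, toAdd_mul,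
      Subgroup.subtype_apply, mem_bestvinaBrady.1 g'.2] at h2
    rw [map_one, toAdd_one] at h2 ⊢
    lia
  have h2 : (wordLength S g : ℝ≥0) ≤ r := by
    have h3 := wordLength_map_le (closure_gens Γ) hS (MonoidHom.id _) hc g
    have h4 : wordLength S g ≤ E * m := by
      refine h3.trans ((Nat.mul_le_mul_left c hgl).trans ?_)
      rw [← mul_assoc]
      exact Nat.mul_le_mul_right m (by lia)
    calc (wordLength S g : ℝ≥0) ≤ E * m := by exact_mod_cast h4
      _ ≤ E * (r / E) := by gcongr
      _ = r := mul_div_cancel₀ r hE0.ne'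
  have h3 : (wordLength T ⟨g, hg⟩ : ℝ≥0∞) ≤ distortion S (bestvinaBrady Γ) T r :=
    le_iSup₂ (f := fun (h : bestvinaBrady Γ) (_ : (wordLength S (h : RAAG Γ) : ℝ≥0) ≤ r) =>
      (wordLength T h : ℝ≥0∞)) ⟨g, hg⟩ h2
  set n := wordLength T ⟨g, hg⟩
  have h4 : m * m ≤ C * (b * n + m) := h1.trans (Nat.mul_le_mul_left C (by lia))
  have hrE : r ≤ 2 * E * m := by
    have h5 : r ≤ E * (m + 1) := by
      rw [div_lt_iff₀ hE0] at hm'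
      rw [mul_comm]; exact hm'.le
    have h6 : (1 : ℝ≥0) ≤ m := by exact_mod_cast (by lia : 1 ≤ m)
    calc r ≤ E * (m + 1) := h5
      _ ≤ E * (m + m) := by gcongr
      _ = _ := by ring
  have hmr : (m : ℝ≥0) ≤ r := by
    refine hm.trans (div_le_self zero_le ?_)
    rw [hE]; push_cast; exact le_add_of_nonneg_left zero_le
  set A : ℝ≥0 := 4 * E ^ 2 * C * (b + 1) with hA
  have h7 : r ^ 2 ≤ A * n + A * r := by
    calc r ^ 2 ≤ (2 * E * m) ^ 2 := by gcongr
      _ = 4 * E ^ 2 * ((m * m : ℕ) : ℝ≥0) := by push_cast; ring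
      _ ≤ 4 * E ^ 2 * ((C * (b * n + m) : ℕ) : ℝ≥0) := by gcongr
      _ = 4 * E ^ 2 * C * (b * n + m) := by push_cast; ring
      _ ≤ 4 * E ^ 2 * C * ((b + 1) * n + (b + 1) * r) := by
        gcongr
        · exact le_add_of_nonneg_right zero_le
        · exact hmr.trans (le_mul_of_one_le_left zero_le (le_add_of_nonneg_left zero_le))
      _ = _ := by ring
  calc ((r ^ 2 : ℝ≥0) : ℝ≥0∞) ≤ ((A * n + A * r : ℝ≥0) : ℝ≥0∞) := ENNReal.coe_le_coe.2 h7
    _ = A * (n : ℝ≥0∞) + A * r := by push_cast; rfl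
    _ ≤ _ := by gcongr

/-- If `Γ` is not a join, some points at the height `N` of the Cayley graph, at distance linear in
`N`, are joined only by paths of length quadratic in `N` if the height is not to vanish. -/
theorem exists_sq_le_lengthDist [Finite V] [Nontrivial V] (h : ¬ IsJoin Γ)
    (hS : Subgroup.closure S = ⊤) (hSfin : S.Finite) :
    ∃ C K : ℕ, ∀ N : ℕ, K ≤ N → ∃ g ∈ bestvinaBrady Γ, wordLength S g ≤ C * N ∧
      ∀ (D : Set (Realization (SimpleGraph.mulCayley S))), (∀ x ∈ D, realHeight Γ S x ≠ 0) →
      ∀ u, (raagHeight Γ u).toAdd = N → ∀ m : ℕ,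
        lengthDist D (vertex _ u) (vertex _ (u * g)) < m → N * N ≤ C * (m + N) := by
  obtain ⟨κ, hκ0, hκ⟩ := exists_height_constant hSfin
  have hf := lipschitzWith_realHeight hS hκ0 hκ
  obtain ⟨C, hC⟩ := exists_long_detour h
  obtain ⟨b, hb⟩ := exists_bound_of_finite hSfin (wordLength (gens Γ))
  obtain ⟨c, hc⟩ := exists_bound_of_finite (finite_gens Γ) (wordLength S)
  obtain ⟨nv, hnv, hnv'⟩ := exists_nearVertex (SimpleGraph.mulCayley S)
  refine ⟨2 * c * C + 3 * b * C + 2 * C, κ + 3 * b, fun N hN => ?_⟩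
  obtain ⟨g, hg, hgl, hdet⟩ := hC (2 * N)
  refine ⟨g, hg, ?_, fun D hD u hu m hm => ?_⟩
  · have h3 := wordLength_map_le (closure_gens Γ) hS (MonoidHom.id _) hc g
    refine h3.trans ((Nat.mul_le_mul_left c hgl).trans ?_)
    rw [show c * (C * (2 * N)) = 2 * c * C * N by ring]
    exact Nat.mul_le_mul_right N (by lia)
  have hpos : 0 < realHeight Γ S (vertex _ u) := by
    rw [realHeight_vertex, hu, Int.cast_natCast, Nat.cast_pos]
    lia
  -- the vertices near a path form a coarse path, which does not go below the height `-κ`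
  obtain ⟨p, hp0, hpm, hpD, hp⟩ := exists_chain_of_lengthDist_lt
    ((lengthDist_inter_pos_le hf.continuous hD hpos _).trans_lt hm)
  have hstep (i : ℕ) : wordLength S ((nv (p i))⁻¹ * nv (p (i + 1))) ≤ 3 := by
    have h1 : (wordLength S ((nv (p i))⁻¹ * nv (p (i + 1))) : ℝ≥0∞) ≤ 1 + 1 + 1 := by
      refine (wordLength_le_edist_vertex hS _ _).trans
        ((edist_triangle4 _ (p i) (p (i + 1)) _).trans ?_)
      gcongr
      · rw [edist_comm]; exact edist_le_one (hnv' _)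
      · exact hp i
      · exact edist_le_one (hnv' _)
    have h2 : (1 + 1 + 1 : ℝ≥0∞) = ((3 : ℕ) : ℝ≥0∞) := by norm_num
    rw [h2] at h1
    exact_mod_cast h1
  obtain ⟨q, hq, hq'⟩ := exists_walk_of_chain (closure_gens Γ) (c := b * 3) (fun i => nv (p i)) m
    (fun i _ => (wordLength_map_le hS (closure_gens Γ) (MonoidHom.id _) hb _).trans
      (Nat.mul_le_mul_left b (hstep i))) (x := u) (y := u * g)
    (by simp only [hp0, hnv]) (by simp only [hpm, hnv])
  have h1 := hdet u q fun z hz => by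
    obtain ⟨i, -, hi⟩ := hq' z hz
    have h2 := (natAbs_height_le _).trans hi
    rw [map_mul (raagHeight Γ), map_inv, toAdd_mul, toAdd_inv] at h2
    have h3 := abs_sub_le_of_lipschitzWith hf (edist_le_one (hnv' (p i)))
    rw [realHeight_vertex] at h3
    have h4 : 0 < realHeight Γ S (p i) := (hpD i).2
    have h5 : -(κ : ℝ) < ((raagHeight Γ (nv (p i))).toAdd : ℝ) := by
      linarith [(abs_le.1 h3).2]
    have h6 : -(κ : ℤ) < (raagHeight Γ (nv (p i))).toAdd := by exact_mod_cast h5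
    rw [hu]
    push_cast
    lia
  calc N * N ≤ 2 * N * (2 * N) := by nlinarith [Nat.zero_le (N * N)]
    _ ≤ C * (q.length + 2 * N) := h1
    _ ≤ C * (b * 3 * m + 2 * N) := Nat.mul_le_mul_left C (by lia)
    _ ≤ _ := by
      have : (2 * c * C + 3 * b * C + 2 * C) * (m + N) = C * (b * 3 * m + 2 * N) +
        (2 * c * C * (m + N) + 2 * C * m + 3 * b * C * N) := by ring
      rw [this]
      exact Nat.le_add_right _ _

end RAAG

end DivergenceBounds

section DivergenceLowerBound

open Realization

variable {V : Type*} {Γ : SimpleGraph V} {S : Set (RAAG Γ)}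

namespace RAAG

/-- Two vertices `u` and `u * g` in the same coset of the Bestvina–Brady subgroup, at large height,
are close to two points at distance `r` from the subgroup: follow a path from `1` to `u`, and its
translate by `u * g * u⁻¹`. -/
theorem exists_pair_mem_nbhdBoundary (hS : Subgroup.closure S = ⊤) {κ b : ℕ} (hκ0 : κ ≠ 0)
    (hκ : ∀ s ∈ S, (raagHeight Γ s).toAdd.natAbs ≤ κ)
    {T : Set (bestvinaBrady Γ)} (hT : Subgroup.closure T = ⊤)
    (hb : ∀ h ∈ T, wordLength S (h : RAAG Γ) ≤ b) {r : ℝ≥0} {u g : RAAG Γ}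
    (hu : κ * r + κ * b + κ ≤ ((raagHeight Γ u).toAdd : ℝ)) (hg : g ∈ bestvinaBrady Γ) :
    ∃ x₁ ∈ nbhdBoundary (baseSet Γ S) r, ∃ x₂ ∈ nbhdBoundary (baseSet Γ S) r,
      outerDist (baseSet Γ S) r x₁ x₂ < ⊤ ∧
      outerDist (baseSet Γ S) r x₁ (vertex _ u) ≤ (wordLength S u + 1 : ℕ) ∧
      outerDist (baseSet Γ S) r x₂ (vertex _ (u * g)) ≤ (wordLength S u + 1 : ℕ) := by
  have hf := lipschitzWith_realHeight hS hκ0 hκ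
  set ℓ := wordLength S u
  obtain ⟨p, hp⟩ := exists_walk hS 1 u
  rw [inv_one, one_mul] at hp
  have h1 : lengthDist Set.univ (vertex (SimpleGraph.mulCayley S) 1) (vertex _ u) <
      (ℓ + 1 : ℕ) := by
    refine (lengthDist_le_length p fun _ _ _ _ => Set.mem_univ _).trans_lt ?_
    exact_mod_cast Nat.lt_succ_of_le hp
  obtain ⟨γ, -, hγ⟩ := exists_path_of_lengthDist_lt h1
  have hur : vertex _ u ∈ (nbhd (baseSet Γ S) r)ᶜ := by
    refine mem_compl_nbhd hf hκ0 (le_trans ?_ (le_abs_self _))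
    rw [realHeight_vertex]
    have : (0 : ℝ) ≤ κ * b + κ := by positivity
    linarith
  obtain ⟨t, ht, ht'⟩ := exists_last_mem_nbhdBoundary γ
    (Set.mem_image_of_mem _ (one_mem (bestvinaBrady Γ))) (not_lt.1 hur)
  have hconj : u * g * u⁻¹ ∈ bestvinaBrady Γ := by
    rw [mem_bestvinaBrady] at hg ⊢
    rw [map_mul (raagHeight Γ), map_mul (raagHeight Γ), map_inv, toAdd_mul, toAdd_mul, toAdd_inv,
      hg]
    lia
  set f := map (mulLeftIso S (u * g * u⁻¹))
  have hfu : f (vertex _ u) = vertex _ (u * g) := by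
    rw [show f (vertex _ u) = vertex _ (u * g * u⁻¹ * u) from map_mulLeftIso_vertex _ _,
      inv_mul_cancel_right]
  have hfmem : Set.MapsTo f (nbhd (baseSet Γ S) r)ᶜ (nbhd (baseSet Γ S) r)ᶜ := fun x hx => by
    simpa only [nbhd, Set.mem_compl_iff, Set.mem_ofPred_eq, f, infEDist_map hconj] using hx
  have e1 : outerDist (baseSet Γ S) r (γ t) (vertex _ u) ≤ (ℓ + 1 : ℕ) :=
    (lengthDist_le_of_tail γ t ht').trans hγ.le
  have e2 : outerDist (baseSet Γ S) r (f (γ t)) (vertex _ (u * g)) ≤ (ℓ + 1 : ℕ) := by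
    rw [← hfu]
    exact (lengthDist_le_of_isometry (isometry_map _) hfmem _ _).trans e1
  obtain ⟨q, -, hq⟩ := exists_walk_of_map hT hS (bestvinaBrady Γ).subtype hb u (u * g) ⟨g, hg⟩ rfl
  have e3 : outerDist (baseSet Γ S) r (vertex _ u) (vertex _ (u * g)) ≤ q.length :=
    lengthDist_le_length q fun w hw z hz => by
      obtain ⟨h, hh⟩ := hq w hw
      have h2 := (natAbs_height_sub_le hS hκ _ w).trans (Nat.mul_le_mul_left κ hh)
      rw [map_mul (raagHeight Γ), toAdd_mul, Subgroup.subtype_apply, mem_bestvinaBrady.1 h.2,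
        add_zero] at h2
      have h3 : ((raagHeight Γ u).toAdd : ℝ) ≤ (raagHeight Γ w).toAdd + κ * b := by
        have : (raagHeight Γ u).toAdd ≤ (raagHeight Γ w).toAdd + (κ * b : ℕ) := by lia
        exact_mod_cast this
      have h4 := (abs_le.1 (abs_sub_le_of_lipschitzWith hf hz)).2
      rw [realHeight_vertex] at h4
      exact mem_compl_nbhd hf hκ0 (le_trans (by linarith) (le_abs_self _))
  refine ⟨γ t, ht, f (γ t), (infEDist_map hconj _).trans ht, ?_, e1, e2⟩
  rw [outerDist, lengthDist_comm] at e2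
  refine ((lengthDist_triangle _ _ (vertex _ (u * g)) _).trans (add_le_add
    ((lengthDist_triangle _ _ (vertex _ u) _).trans (add_le_add e1 e3)) e2)).trans_lt ?_
  exact_mod_cast ENNReal.natCast_lt_top (ℓ + 1 + q.length + (ℓ + 1))

/-- If `Γ` is not a join, the relative divergence is at least quadratic. -/
theorem exists_sq_le_groupDivergence [Finite V] [Nontrivial V] (h : ¬ IsJoin Γ)
    (hS : Subgroup.closure S = ⊤) (hSfin : S.Finite) {T : Set (bestvinaBrady Γ)}
    (hT : Subgroup.closure T = ⊤) (hTfin : T.Finite) :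
    ∃ M : ℕ, 0 < M ∧ ∃ A : ℝ≥0, ∀ n : ℕ, 1 ≤ n → ∀ ρ : ℝ≥0, 0 < ρ → ρ ≤ 1 →
      ∃ D : ℝ≥0, ∀ r : ℝ≥0, D < r →
        (r ^ 2 : ℝ≥0) ≤ A * groupDivergence S (bestvinaBrady Γ) (M * n) ρ r + A * r := by
  obtain ⟨κ, hκ0, hκ⟩ := exists_height_constant hSfin
  have hf := lipschitzWith_realHeight hS hκ0 hκ
  obtain ⟨c, hc1, hc⟩ := exists_le_abs_realHeight hS hf
  obtain ⟨b, hb⟩ := exists_bound_of_finite hTfin fun h => wordLength S (h : RAAG Γ)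
  obtain ⟨C, K, hCK⟩ := exists_sq_le_lengthDist h hS hSfin
  obtain ⟨t⟩ : Nonempty V := inferInstance
  set d := wordLength S (gen Γ t)
  set K₀ := K + κ * b + κ
  -- `E` bounds the distances of the four points of the construction, up to a factor `r`
  set E := d * (κ + 1) + 1 with hE
  refine ⟨2 * E + C * (κ + 1) + 1, by lia, C * (2 * E + κ + 2) + 1, fun n hn ρ hρ hρ1 =>
    ⟨c / ρ + K₀ + 1, fun r hr => ?_⟩⟩
  have hrK : (K₀ + 1 : ℝ≥0) ≤ r := by
    refine le_trans ?_ hr.le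
    rw [add_assoc]
    exact le_add_of_nonneg_left zero_le
  have hr1 : (1 : ℝ≥0) ≤ r := (le_add_of_nonneg_left zero_le).trans hrK
  -- this keeps the height from vanishing at distance at least `ρ * r`
  have hρr : (c : ℝ≥0) < ρ * r := by
    rw [mul_comm, ← div_lt_iff₀ hρ]
    refine lt_of_le_of_lt ?_ hr
    rw [add_assoc]
    exact le_add_of_nonneg_right zero_le
  -- at the height `N`, a vertex and the walk in its coset are at distance at least `r` from the
  -- Bestvina–Brady subgroup
  set N := ⌈(κ : ℝ≥0) * r⌉₊ + K₀ with hN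
  have hN1 : (κ : ℝ≥0) * r + K₀ ≤ N := by
    rw [hN]; push_cast; gcongr; exact Nat.le_ceil _
  have hN2 : (N : ℝ≥0) ≤ (κ + 1) * r := by
    rw [hN]; push_cast
    calc (⌈(κ : ℝ≥0) * r⌉₊ : ℝ≥0) + K₀ ≤ κ * r + 1 + K₀ := by
          gcongr; exact (Nat.ceil_lt_add_one zero_le).le
      _ = κ * r + (K₀ + 1) := by ring
      _ ≤ κ * r + r := by gcongr
      _ = _ := by ring
  have hrN : r ≤ N := by
    refine le_trans ?_ hN1
    exact (le_mul_of_one_le_left zero_le (by exact_mod_cast Nat.one_le_iff_ne_zero.2 hκ0)).trans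
      (le_add_of_nonneg_right zero_le)
  set u := gen Γ t ^ (N : ℤ) with hu
  have hheight : (raagHeight Γ u).toAdd = N := by
    rw [hu, map_zpow, toAdd_zpow, height_gen]; simp
  have hul : wordLength S u ≤ N * d := (wordLength_zpow_le hS (gen Γ t) N).trans_eq (by simp [d])
  obtain ⟨g, hg, hgl, hlow⟩ := hCK N (by lia)
  obtain ⟨x₁, hx₁, x₂, hx₂, hfin, e1, e2⟩ := exists_pair_mem_nbhdBoundary (r := r) (u := u) hS hκ0
    hκ hT hb (by
      rw [hheight]
      have h1 : (κ : ℝ≥0) * r + (K + κ * b + κ) ≤ N := by exact_mod_cast hN1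
      have h2 : (κ : ℝ) * r + (K + κ * b + κ) ≤ N := by exact_mod_cast h1
      push_cast
      have : (0 : ℝ) ≤ K := by positivity
      linarith) hg
  have hEr : ((wordLength S u + 1 : ℕ) : ℝ≥0) ≤ E * r := by
    calc ((wordLength S u + 1 : ℕ) : ℝ≥0) ≤ ((N * d + 1 : ℕ) : ℝ≥0) := by exact_mod_cast by lia
      _ = N * d + 1 := by push_cast; rfl
      _ ≤ (κ + 1) * r * d + r := by gcongr
      _ = E * r := by rw [hE]; push_cast; ring
  have hEr' : ((wordLength S u + 1 : ℕ) : ℝ≥0∞) ≤ (E * r : ℝ≥0) := by exact_mod_cast hEr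
  replace e1 := e1.trans hEr'
  replace e2 := e2.trans hEr'
  set R := outerDist (baseSet Γ S) (ρ * r) x₁ x₂ with hR
  have hdist : edist x₁ x₂ ≤ ((2 * E + C * (κ + 1) + 1) * n : ℕ) * (r : ℝ≥0∞) := by
    have h1 := (edist_le_lengthDist _ _ _).trans e1
    have h2 := (edist_le_lengthDist _ _ _).trans e2
    have h3 : edist (vertex (SimpleGraph.mulCayley S) u) (vertex _ (u * g)) ≤
        (C * ((κ + 1) * r) : ℝ≥0) := by
      refine (edist_vertex_le_wordLength hS _ _).trans ?_
      rw [inv_mul_cancel_left]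
      have : (wordLength S g : ℝ≥0) ≤ C * ((κ + 1) * r) := by
        calc (wordLength S g : ℝ≥0) ≤ (C * N : ℕ) := by exact_mod_cast hgl
          _ = C * N := by push_cast; rfl
          _ ≤ _ := by gcongr
      exact_mod_cast this
    rw [edist_comm] at h2
    refine ((edist_triangle4 _ _ _ _).trans (add_le_add (add_le_add h1 h3) h2)).trans ?_
    have h4 : E * r + C * ((κ + 1) * r) + E * r ≤ ((2 * E + C * (κ + 1) + 1) * n : ℕ) * r := by
      have hn' : (1 : ℝ≥0) ≤ n := by exact_mod_cast hn
      calc E * r + C * ((κ + 1) * r) + E * r = (2 * E + C * (κ + 1)) * 1 * r := by ring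
        _ ≤ (2 * E + C * (κ + 1) + 1) * n * r := by
          refine mul_le_mul_left (mul_le_mul' (le_add_of_nonneg_right zero_le) hn') _
        _ = _ := by push_cast; ring
    exact_mod_cast h4
  have hRle : R ≤ groupDivergence S (bestvinaBrady Γ) ((2 * E + C * (κ + 1) + 1) * n) ρ r :=
    le_iSup_of_le x₁ (le_iSup_of_le x₂ (le_iSup_of_le hx₁ (le_iSup_of_le hx₂
      (le_iSup_of_le hfin (le_iSup_of_le hdist le_rfl)))))
  suffices hmain : ((r ^ 2 : ℝ≥0) : ℝ≥0∞) ≤ (C * (2 * E + κ + 2) + 1 : ℝ≥0) * R +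
      (C * (2 * E + κ + 2) + 1 : ℝ≥0) * r from hmain.trans (by gcongr)
  rcases eq_or_ne R ⊤ with hRtop | hRtop
  · rw [hRtop, ENNReal.mul_top, top_add]
    · exact le_top
    · exact_mod_cast (by positivity : (C * (2 * E + κ + 2) + 1 : ℝ≥0) ≠ 0)
  lift R to ℝ≥0 using hRtop with R₀
  set m := ⌊R₀ + 2 * (E * r)⌋₊ + 1 with hm
  have hmain := hlow (nbhd (baseSet Γ S) (ρ * r))ᶜ (fun x hx h0 => by
    have h1 := hc _ x hx
    rw [h0, abs_zero, mul_zero, zero_add] at h1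
    exact absurd hρr (not_lt.2 (by exact_mod_cast h1))) u hheight m (by
    have hsub : (nbhd (baseSet Γ S) r)ᶜ ⊆ (nbhd (baseSet Γ S) (ρ * r))ᶜ := fun x hx hx' => by
      refine hx (show Metric.infEDist x _ < r from lt_of_lt_of_le hx' ?_)
      exact_mod_cast mul_le_of_le_one_left zero_le hρ1
    have e1' := (lengthDist_anti hsub _ _).trans e1
    have e2' := (lengthDist_anti hsub _ _).trans e2
    rw [lengthDist_comm] at e1'
    refine ((lengthDist_triangle _ _ x₂ _).trans (add_le_add
      ((lengthDist_triangle _ _ x₁ _).trans (add_le_add e1' hR.ge)) e2')).trans_lt ?_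
    have : E * r + R₀ + E * r < m := by
      rw [hm]; push_cast
      refine lt_of_eq_of_lt ?_ (Nat.lt_floor_add_one _)
      ring
    exact_mod_cast this)
  have hm' : (m : ℝ≥0) ≤ R₀ + (2 * E + 1) * r := by
    rw [hm]; push_cast
    calc (⌊R₀ + 2 * (E * r)⌋₊ : ℝ≥0) + 1 ≤ R₀ + 2 * (E * r) + r :=
          add_le_add (Nat.floor_le zero_le) hr1
      _ = _ := by ring
  have key : r ^ 2 ≤ (C * (2 * E + κ + 2) + 1) * R₀ + (C * (2 * E + κ + 2) + 1) * r := by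
    calc r ^ 2 ≤ (N : ℝ≥0) ^ 2 := by gcongr
      _ = ((N * N : ℕ) : ℝ≥0) := by push_cast; ring
      _ ≤ ((C * (m + N) : ℕ) : ℝ≥0) := by exact_mod_cast hmain
      _ = C * (m + N) := by push_cast; rfl
      _ ≤ C * (R₀ + (2 * E + 1) * r + (κ + 1) * r) := by gcongr
      _ ≤ C * (R₀ + (2 * E + 1) * r + (κ + 1) * r) + (C * (2 * E + κ + 1) * R₀ + R₀ + r) :=
          le_add_of_nonneg_right zero_le
      _ = _ := by ring
  exact_mod_cast key

end RAAG

end DivergenceLowerBound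

/-! ### Polynomial growth -/

section PolynomialGrowth

open Filter Polynomial

theorem tendsto_eval_div_pow (p : ℝ[X]) :
    Tendsto (fun x : ℝ => p.eval x / x ^ p.natDegree) atTop (nhds p.leadingCoeff) := by
  have h := Polynomial.div_tendsto_atTop_leadingCoeff_div_of_degree_eq p (X ^ p.natDegree)
  rcases eq_or_ne p 0 with rfl | hp
  · simp
  · simpa using h (by rw [degree_X_pow, degree_eq_natDegree hp])

/-- A nonnegative polynomial of degree `k ≥ 1` lies between two positive multiples of `x ^ k`, for
large `x`. -/
theorem exists_polyFun_bounds {p : ℝ[X]} {k : ℕ} (hk : k ≠ 0) (hdeg : p.natDegree = k)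
    (hp : ∀ x : ℝ, 0 ≤ x → 0 ≤ p.eval x) :
    ∃ a b D : ℝ≥0, 0 < a ∧ 0 < b ∧ ∀ x : ℝ≥0, D < x →
      a * x ^ k ≤ polyFun p x ∧ polyFun p x ≤ b * x ^ k := by
  have hlim := tendsto_eval_div_pow p
  rw [hdeg] at hlim
  have h0 : 0 ≤ p.leadingCoeff := by
    refine ge_of_tendsto hlim ((eventually_gt_atTop 0).mono fun x hx => ?_)
    exact div_nonneg (hp x hx.le) (pow_nonneg hx.le k)
  have hne : p.leadingCoeff ≠ 0 := by
    rw [Ne, leadingCoeff_eq_zero]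
    rintro rfl
    exact hk (by simpa using hdeg.symm)
  have hpos : 0 < p.leadingCoeff := lt_of_le_of_ne h0 hne.symm
  obtain ⟨D, hD⟩ := eventually_atTop.1 ((hlim.eventually_const_lt (half_lt_self hpos)).and
    ((hlim.eventually_lt_const (lt_two_mul_self hpos)).and (eventually_gt_atTop 0)))
  refine ⟨(p.leadingCoeff / 2).toNNReal, (2 * p.leadingCoeff).toNNReal, D.toNNReal, by simpa,
    by simpa, fun x hx => ?_⟩
  obtain ⟨h1, h2, hx0⟩ := hD x (Real.toNNReal_le_iff_le_coe.1 hx.le)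
  have hxk : 0 < (x : ℝ) ^ k := pow_pos hx0 k
  have hcoe : (x : ℝ≥0∞) ^ k = ENNReal.ofReal ((x : ℝ) ^ k) := by
    rw [ENNReal.ofReal_pow x.coe_nonneg, ENNReal.ofReal_coe_nnreal]
  rw [lt_div_iff₀ hxk] at h1
  rw [div_lt_iff₀ hxk] at h2
  rw [hcoe]
  constructor
  · exact (ENNReal.ofReal_mul (by positivity)).symm.trans_le (ENNReal.ofReal_le_ofReal h1.le)
  · exact (ENNReal.ofReal_le_ofReal h2.le).trans_eq (ENNReal.ofReal_mul (by positivity))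

theorem dominated_polyFun {p : ℝ[X]} {k : ℕ} (hk : k ≠ 0) (hdeg : p.natDegree = k)
    (hp : ∀ x : ℝ, 0 ≤ x → 0 ≤ p.eval x) {f : ℝ≥0 → ℝ≥0∞} {A D : ℝ≥0}
    (hf : ∀ r : ℝ≥0, D < r → f r ≤ (A * r ^ k : ℝ≥0)) : Dominated f (polyFun p) := by
  obtain ⟨a, b, D', ha, -, hab⟩ := exists_polyFun_bounds hk hdeg hp
  refine ⟨(A + 1) / a, 1, 1, D + D' + 1, by positivity, one_pos, one_pos, by positivity,
    fun x hx => ?_⟩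
  have hD : D < x := lt_of_le_of_lt (by rw [add_assoc]; exact le_add_of_nonneg_right zero_le) hx
  have hD' : D' < x := lt_of_le_of_lt
    (by rw [add_right_comm]; exact le_add_of_nonneg_left zero_le) hx
  rw [one_mul]
  calc f x ≤ (A * x ^ k : ℝ≥0) := hf x hD
    _ ≤ ((A + 1) / a * (a * x ^ k) : ℝ≥0) := by
      rw [← mul_assoc, div_mul_cancel₀ _ ha.ne']
      gcongr
      exact le_add_of_nonneg_right zero_le
    _ = ((A + 1) / a : ℝ≥0) * (a * (x : ℝ≥0∞) ^ k) := by push_cast; rfl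
    _ ≤ ((A + 1) / a : ℝ≥0) * polyFun p x := by gcongr; exact (hab x hD').1
    _ ≤ _ := le_add_of_nonneg_right zero_le

/-- A linear polynomial is absorbed by the linear error term in the definition of domination. -/
theorem polyFun_dominated_of_natDegree_eq_one {p : ℝ[X]} (hdeg : p.natDegree = 1)
    (hp : ∀ x : ℝ, 0 ≤ x → 0 ≤ p.eval x) (f : ℝ≥0 → ℝ≥0∞) : Dominated (polyFun p) f := by
  obtain ⟨a, b, D, -, hb, hab⟩ := exists_polyFun_bounds one_ne_zero hdeg hp
  refine ⟨1, 1, b, D + 1, one_pos, one_pos, hb, by positivity, fun x hx => ?_⟩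
  have h := (hab x (lt_of_le_of_lt (le_add_of_nonneg_right zero_le) hx)).2
  rw [pow_one] at h
  exact h.trans (le_add_of_nonneg_left zero_le)

theorem polyFun_dominated_of_sq_le {p : ℝ[X]} (hdeg : p.natDegree = 2)
    (hp : ∀ x : ℝ, 0 ≤ x → 0 ≤ p.eval x) {f : ℝ≥0 → ℝ≥0∞} {A D : ℝ≥0}
    (hf : ∀ r : ℝ≥0, D < r → (r ^ 2 : ℝ≥0) ≤ A * f r + A * r) : Dominated (polyFun p) f := by
  obtain ⟨a, b, D', -, hb, hab⟩ := exists_polyFun_bounds two_ne_zero hdeg hp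
  refine ⟨b * (A + 1), 1, b * (A + 1), D + D' + 1, by positivity, one_pos, by positivity,
    by positivity, fun x hx => ?_⟩
  have hD : D < x := lt_of_le_of_lt (by rw [add_assoc]; exact le_add_of_nonneg_right zero_le) hx
  have hD' : D' < x := lt_of_le_of_lt
    (by rw [add_right_comm]; exact le_add_of_nonneg_left zero_le) hx
  have h1 := hf x hD
  rw [one_mul]
  calc polyFun p x ≤ b * (x : ℝ≥0∞) ^ 2 := (hab x hD').2
    _ ≤ b * (A * f x + A * x) := by gcongr; exact_mod_cast h1
    _ ≤ b * ((A + 1) * f x + (A + 1) * x) := by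
      gcongr <;> exact le_add_of_nonneg_right zero_le
    _ = _ := by push_cast; ring

theorem hasPolyGrowth_one {f : ℝ≥0 → ℝ≥0∞} {A D : ℝ≥0}
    (hf : ∀ r : ℝ≥0, D < r → f r ≤ (A * r ^ 1 : ℝ≥0)) : HasPolyGrowth 1 f := fun _ hdeg hp =>
  ⟨dominated_polyFun one_ne_zero hdeg hp hf, polyFun_dominated_of_natDegree_eq_one hdeg hp f⟩

theorem hasPolyGrowth_two {f : ℝ≥0 → ℝ≥0∞} {A A' D D' : ℝ≥0}
    (hf : ∀ r : ℝ≥0, D < r → f r ≤ (A * r ^ 2 : ℝ≥0))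
    (hf' : ∀ r : ℝ≥0, D' < r → (r ^ 2 : ℝ≥0) ≤ A' * f r + A' * r) :
    HasPolyGrowth 2 f := fun _ hdeg hp =>
  ⟨dominated_polyFun two_ne_zero hdeg hp hf, polyFun_dominated_of_sq_le hdeg hp hf'⟩

theorem distortion_le {G : Type*} [Group G] {S : Set G} {H : Subgroup G} {T : Set H} {k C : ℕ}
    (h : ∀ h : H, wordLength T h ≤ C * wordLength S (h : G) ^ k) (r : ℝ≥0) :
    distortion S H T r ≤ (C * r ^ k : ℝ≥0) := by
  refine iSup₂_le fun x hx => ?_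
  have h1 : (wordLength T x : ℝ≥0) ≤ C * r ^ k := by
    calc (wordLength T x : ℝ≥0) ≤ ((C * wordLength S (x : G) ^ k : ℕ) : ℝ≥0) := by
          exact_mod_cast h x
      _ = C * (wordLength S (x : G) : ℝ≥0) ^ k := by push_cast; rfl
      _ ≤ _ := by gcongr
  exact_mod_cast h1

end PolynomialGrowth

theorem theorem1p1 {V : Type*} [Finite V] [Nontrivial V] (Γ : SimpleGraph V) (hΓ : Γ.Connected) :
    (bestvinaBrady Γ).FG ∧
    ∀ (S : Set (RAAG Γ)) (T : Set (bestvinaBrady Γ)),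
      S.Finite → Subgroup.closure S = ⊤ → T.Finite → Subgroup.closure T = ⊤ →
      (IsJoin Γ →
        FamilyHasPolyGrowth 1 (groupDivergence S (bestvinaBrady Γ)) ∧
        HasPolyGrowth 1 (distortion S (bestvinaBrady Γ) T)) ∧
      (¬ IsJoin Γ →
        FamilyHasPolyGrowth 2 (groupDivergence S (bestvinaBrady Γ)) ∧
        HasPolyGrowth 2 (distortion S (bestvinaBrady Γ) T)) := by
  refine ⟨?_, fun S T hSfin hS hTfin hT => ⟨fun hJ => ?_, fun hJ => ?_⟩⟩
  · exact (Group.fg_iff_subgroup_fg _).1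
      (Group.fg_iff.2 ⟨RAAG.edgeGens Γ, RAAG.closure_edgeGens hΓ, RAAG.finite_edgeGens Γ⟩)
  · obtain ⟨C, hC⟩ :=
      RAAG.exists_wordLength_le_pow hΓ (RAAG.exists_edgeWord_le_of_isJoin hJ) hSfin hS hT
    obtain ⟨L, hL0, hL1, hL⟩ := RAAG.exists_groupDivergence_le hS hSfin hT hTfin one_ne_zero ⟨C, hC⟩
    refine ⟨fun p hdeg hp => ⟨⟨L, hL0, hL1, 1, one_pos, fun n _ ρ _ hρ => ?_⟩,
      ⟨1, one_pos, le_rfl, 1, one_pos, fun n _ ρ _ _ =>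
        polyFun_dominated_of_natDegree_eq_one hdeg hp _⟩⟩,
      hasPolyGrowth_one (D := 0) fun r _ => distortion_le hC r⟩
    obtain ⟨A, D, hA⟩ := hL n
    exact dominated_polyFun one_ne_zero hdeg hp (hA ρ hρ)
  · obtain ⟨C, hC⟩ := RAAG.exists_wordLength_le_pow hΓ (RAAG.exists_edgeWord_le_sq hΓ) hSfin hS hT
    obtain ⟨L, hL0, hL1, hL⟩ := RAAG.exists_groupDivergence_le hS hSfin hT hTfin two_ne_zero ⟨C, hC⟩
    obtain ⟨M, hM0, A', hA'⟩ := RAAG.exists_sq_le_groupDivergence hJ hS hSfin hT hTfin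
    obtain ⟨A'', D'', hA''⟩ := RAAG.exists_sq_le_distortion hJ hS hT hTfin
    refine ⟨fun p hdeg hp => ⟨⟨L, hL0, hL1, 1, one_pos, fun n _ ρ _ hρ => ?_⟩,
      ⟨1, one_pos, le_rfl, M, hM0, fun n hn ρ hρ hρ1 => ?_⟩⟩,
      hasPolyGrowth_two (D := 0) (fun r _ => distortion_le hC r) hA''⟩
    · obtain ⟨A, D, hA⟩ := hL n
      exact dominated_polyFun two_ne_zero hdeg hp (hA ρ hρ)
    · obtain ⟨D, hD⟩ := hA' n (by lia) ρ hρ hρ1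
      exact polyFun_dominated_of_sq_le hdeg hp hD
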